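/- **Definitions.** The rudimentary functions (from $n$-tuples of sets to sets) are the functions generated from $F(x_1,\dots,x_n)=x_i$, $F(x_1,\dots,x_n)=\{x_i,x_j\}$ and $F(x_1,\dots,x_n)=x_i\setminus x_j$ by composition and by the scheme $F(x_1,\dots,x_n)=\bigcup_{y\in x_1}H(y,x_2,\dots,x_n)$. The rudimentary closure of a set $x$ is the smallest set $y$ with $x\subseteq y$, $x\in y$ that is closed under all rudimentary functions; $J_1$ is the rudimentary closure of $J_0=\emptyset$ and $J_2$ is the rudimentary closure of $J_1$. A definable subset of a set $x$ is a set $\{y\in x:\phi^x(y,x_1,\dots,x_k)\}$ with $x_1,\dots,x_k\in x$ and $\phi$ a first-order formula in the symbols $\in,\subseteq,=$ whose quantifiers range over $x$. An *$\iota$-set* is an element of $J_2$. An *$\iota$-class* is a definable subset of $J_2$ whose intersection with every $\iota$-set is an $\iota$-set. An *$\iota$-relation* on an $\iota$-class $X$ is an $\iota$-class contained in $X\times X$ (with ordered pairs $\langle a,b\rangle=\{\{a\},\{a,b\}\}$); an *equivalence $\iota$-relation* is an $\iota$-relation that is an equivalence relation on $X$. A *universal well-ordering* is an $\iota$-relation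 $\preceq_{\mathcal U}$ on $J_2$ that well-orders $J_2$ in such a way that each proper initial segment is an $\iota$-set and each $\iota$-set is contained in a proper initial segment. Given a universal well-ordering $\preceq_{\mathcal U}$ and an equivalence $\iota$-relation $\sim$ on an $\iota$-class $X$, the *quotient* is $$X/{\sim}=\{a\in X:\ (\forall b)[(b\in X\wedge a\sim b)\Rightarrow a\preceq_{\mathcal U}b]\}.$$ **Proposition.** A universal well-ordering $\preceq_{\mathcal U}$ of $J_2$ exists, and for every choice of $\preceq_{\mathcal U}$ the following hold. If $X$ is an $\iota$-set and $\sim$ is an equivalence $\iota$-relation on $X$, then $X/{\sim}$ is an $\iota$-set. If $X$ is an $\iota$-class and $\sim$ is an equivalence $\iota$-relation on $X$, then $X/{\sim}$ is an $\iota$-class. -/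

import Mathlib

namespace AnalysisJ2

/-! ### Rudimentary functions -/

/-- Rudimentary functions from `n`-tuples of sets to sets.  In the last clause
`Function.update x 0 y` is the tuple `(y, x₂, …, xₙ)`, so the value is
`⋃_{y ∈ x₁} H(y, x₂, …, xₙ)`. -/
inductive Rudimentary : {n : ℕ} → ((Fin n → ZFSet.{0}) → ZFSet.{0}) → Prop
  | proj {n : ℕ} (i : Fin n) : Rudimentary (fun x => x i)
  | pair {n : ℕ} (i j : Fin n) : Rudimentary (fun x => {x i, x j})
  | diff {n : ℕ} (i j : Fin n) : Rudimentary (fun x => x i \ x j)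
  | comp {n k : ℕ} {G : (Fin k → ZFSet.{0}) → ZFSet.{0}}
      {H : Fin k → (Fin n → ZFSet.{0}) → ZFSet.{0}}
      (hG : Rudimentary G) (hH : ∀ i, Rudimentary (H i)) :
      Rudimentary (fun x => G (fun i => H i x))
  | union {n : ℕ} {H : (Fin (n + 1) → ZFSet.{0}) → ZFSet.{0}} (hH : Rudimentary H) :
      Rudimentary (fun x : Fin (n + 1) → ZFSet.{0} =>
        ZFSet.iUnion (fun y : x 0 => H (Function.update x 0 y)))

/-- `y` is closed under application of all rudimentary functions. -/
def RudClosed (y : ZFSet.{0}) : Prop :=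
  ∀ ⦃n : ℕ⦄ ⦃F : (Fin n → ZFSet.{0}) → ZFSet.{0}⦄, Rudimentary F →
    ∀ v : Fin n → ZFSet.{0}, (∀ i, v i ∈ y) → F v ∈ y

/-- The sets generated from the elements of `x` and `x` itself by rudimentary functions. -/
inductive RudGenerated (x : ZFSet.{0}) : ZFSet.{0} → Prop
  | mem {z : ZFSet.{0}} (hz : z ∈ x) : RudGenerated x z
  | self : RudGenerated x x
  | app {n : ℕ} {F : (Fin n → ZFSet.{0}) → ZFSet.{0}} (hF : Rudimentary F)
      (v : Fin n → ZFSet.{0}) (hv : ∀ i, RudGenerated x (v i)) : RudGenerated x (F v)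

/-! Codes, used only to see that the sets in `RudGenerated x` are few enough to form a set. -/

/-- Codes for rudimentary functions. -/
inductive RudCode : ℕ → Type
  | proj {n : ℕ} (i : Fin n) : RudCode n
  | pair {n : ℕ} (i j : Fin n) : RudCode n
  | diff {n : ℕ} (i j : Fin n) : RudCode n
  | comp {n k : ℕ} (g : RudCode k) (h : Fin k → RudCode n) : RudCode n
  | union {n : ℕ} (h : RudCode (n + 1)) : RudCode (n + 1)

/-- The function with a given code. -/
noncomputable def RudCode.eval : {n : ℕ} → RudCode n → (Fin n → ZFSet.{0}) → ZFSet.{0}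
  | _, .proj i => fun x => x i
  | _, .pair i j => fun x => {x i, x j}
  | _, .diff i j => fun x => x i \ x j
  | _, .comp g h => fun x => g.eval (fun i => (h i).eval x)
  | _, .union h => fun x => ZFSet.iUnion (fun y : x 0 => h.eval (Function.update x 0 y))

theorem Rudimentary.exists_code {n : ℕ} {F : (Fin n → ZFSet.{0}) → ZFSet.{0}}
    (hF : Rudimentary F) : ∃ c : RudCode n, c.eval = F := by
  induction hF with
  | proj i => exact ⟨.proj i, rfl⟩
  | pair i j => exact ⟨.pair i j, rfl⟩
  | diff i j => exact ⟨.diff i j, rfl⟩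
  | comp _ _ ihG ihH =>
    obtain ⟨g, rfl⟩ := ihG
    choose h hh using ihH
    refine ⟨.comp g h, ?_⟩
    simp only [RudCode.eval, hh]
  | union _ ih =>
    obtain ⟨h, rfl⟩ := ih
    exact ⟨.union h, rfl⟩

/-- Codes for the elements of the rudimentary closure of `x`. -/
inductive GenCode (x : ZFSet.{0}) : Type
  | mem (z : Shrink.{0} x) : GenCode x
  | self : GenCode x
  | app {n : ℕ} (c : RudCode n) (v : Fin n → GenCode x) : GenCode x

/-- The set with a given code. -/
noncomputable def GenCode.eval {x : ZFSet.{0}} : GenCode x → ZFSet.{0}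
  | .mem z => ((equivShrink x).symm z : x)
  | .self => x
  | .app c v => c.eval (fun i => (v i).eval)

theorem RudGenerated.exists_code {x z : ZFSet.{0}} (h : RudGenerated x z) :
    ∃ c : GenCode x, c.eval = z := by
  induction h with
  | mem hz => exact ⟨.mem (equivShrink x ⟨_, hz⟩), by simp [GenCode.eval]⟩
  | self => exact ⟨.self, rfl⟩
  | app hF v _ ih =>
    obtain ⟨c, rfl⟩ := hF.exists_code
    choose w hw using ih
    refine ⟨.app c w, ?_⟩
    simp only [GenCode.eval, hw]

/-- The rudimentary closure of `x`; see `isLeast_rudClosure`. -/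
noncomputable def rudClosure (x : ZFSet.{0}) : ZFSet.{0} :=
  ZFSet.sep (RudGenerated x) (ZFSet.range (GenCode.eval (x := x)))

theorem mem_rudClosure {x z : ZFSet.{0}} : z ∈ rudClosure x ↔ RudGenerated x z := by
  rw [rudClosure, ZFSet.mem_sep, ZFSet.mem_range]
  exact ⟨fun h => h.2, fun h => ⟨h.exists_code, h⟩⟩

/-- The rudimentary closure of `x` is the smallest set `y` such that `x ⊆ y`, `x ∈ y` and `y` is
closed under all rudimentary functions. -/
theorem isLeast_rudClosure (x : ZFSet.{0}) :
    IsLeast {y : ZFSet.{0} | x ⊆ y ∧ x ∈ y ∧ RudClosed y} (rudClosure x) := by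
  refine ⟨⟨fun z hz => mem_rudClosure.2 (.mem hz), mem_rudClosure.2 .self,
    fun n F hF v hv => mem_rudClosure.2 (.app hF v fun i => mem_rudClosure.1 (hv i))⟩, ?_⟩
  rintro y ⟨hsub, hmem, hcl⟩
  intro z hz
  have h := mem_rudClosure.1 hz
  clear hz
  induction h with
  | mem hz => exact hsub hz
  | self => exact hmem
  | app hF v _ ih => exact hcl hF v ih

/-- The first set of Jensen's hierarchy (`J₀ = ∅`). -/
noncomputable def J1 : ZFSet.{0} := rudClosure ∅

/-- The second set of Jensen's hierarchy. -/
noncomputable def J2 : ZFSet.{0} := rudClosure J1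

/-! ### Definable subsets -/

/-- The non-logical symbols `∈` and `⊆` of the language of set theory (equality is a logical symbol
of Mathlib's first-order formulas). -/
inductive SetRel : ℕ → Type
  | mem : SetRel 2
  | subset : SetRel 2

/-- The first-order language of set theory. -/
def setLanguage : FirstOrder.Language.{0, 0} := ⟨fun _ => Empty, SetRel⟩

/-- The symbol `∈`. -/
abbrev memSymb : setLanguage.Relations 2 := SetRel.mem

/-- The symbol `⊆`. -/
abbrev subsetSymb : setLanguage.Relations 2 := SetRel.subset

/-- A set `x` as a structure for the language of set theory: quantifiers range over the elements
of `x`, and `∈`, `⊆` have their usual meaning. -/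
instance setStructure (x : ZFSet.{0}) : setLanguage.Structure x where
  funMap := fun f => f.elim
  RelMap := fun r =>
    match r with
    | .mem => fun v => (v 0 : ZFSet.{0}) ∈ (v 1 : ZFSet.{0})
    | .subset => fun v => (v 0 : ZFSet.{0}) ⊆ (v 1 : ZFSet.{0})

/-- `Y` is a definable subset of `x`: the set of the `y ∈ x` that satisfy a first-order formula
relativized to `x`, with parameters from `x`. -/
def IsDefinableSubset (x : ZFSet.{0}) (Y : Set ZFSet.{0}) : Prop :=
  ∃ S : Set x, (Set.univ : Set x).Definable₁ setLanguage S ∧ Y = Subtype.val '' S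

/-! ### `ι`-sets, `ι`-classes, `ι`-relations -/

/-- A collection of sets is an `ι`-set if it is (the extension of) an element of `J₂`. -/
def IsIotaSet (X : Set ZFSet.{0}) : Prop :=
  ∃ x ∈ J2, (x : Set ZFSet.{0}) = X

/-- An `ι`-class is a definable subset of `J₂` whose intersection with every `ι`-set is an
`ι`-set. -/
def IsIotaClass (X : Set ZFSet.{0}) : Prop :=
  IsDefinableSubset J2 X ∧ ∀ Y : Set ZFSet.{0}, IsIotaSet Y → IsIotaSet (X ∩ Y)

/-- `R` is an `ι`-relation on `X`: an `ι`-class contained in `X × X`. -/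
def IsIotaRelation (R X : Set ZFSet.{0}) : Prop :=
  IsIotaClass R ∧ ∀ z ∈ R, ∃ a ∈ X, ∃ b ∈ X, z = ZFSet.pair a b

/-- `E` is an equivalence `ι`-relation on `X`. -/
structure IsEquivalenceIotaRelation (E X : Set ZFSet.{0}) : Prop where
  iotaRelation : IsIotaRelation E X
  refl : ∀ a ∈ X, ZFSet.pair a a ∈ E
  symm : ∀ a ∈ X, ∀ b ∈ X, ZFSet.pair a b ∈ E → ZFSet.pair b a ∈ E
  trans : ∀ a ∈ X, ∀ b ∈ X, ∀ c ∈ X,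
    ZFSet.pair a b ∈ E → ZFSet.pair b c ∈ E → ZFSet.pair a c ∈ E

/-! ### Universal well-orderings and quotients -/

/-- `W`, as a reflexive order relation, well-orders `X`. -/
structure WellOrders (W X : Set ZFSet.{0}) : Prop where
  refl : ∀ a ∈ X, ZFSet.pair a a ∈ W
  antisymm : ∀ a ∈ X, ∀ b ∈ X, ZFSet.pair a b ∈ W → ZFSet.pair b a ∈ W → a = b
  trans : ∀ a ∈ X, ∀ b ∈ X, ∀ c ∈ X,
    ZFSet.pair a b ∈ W → ZFSet.pair b c ∈ W → ZFSet.pair a c ∈ W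
  total : ∀ a ∈ X, ∀ b ∈ X, ZFSet.pair a b ∈ W ∨ ZFSet.pair b a ∈ W
  exists_least : ∀ S ⊆ X, S.Nonempty → ∃ a ∈ S, ∀ b ∈ S, ZFSet.pair a b ∈ W

/-- `S` is a (proper) initial segment of `J₂` with respect to `W`. -/
def IsInitialSegment (W S : Set ZFSet.{0}) : Prop :=
  S ⊂ (J2 : Set ZFSet.{0}) ∧ ∀ a ∈ S, ∀ b ∈ J2, ZFSet.pair b a ∈ W → b ∈ S

/-- `W` is a universal well-ordering: an `ι`-relation which well-orders `J₂` in such a way that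
each initial segment is an `ι`-set and each `ι`-set is contained in an initial segment. -/
structure IsUniversalWellOrdering (W : Set ZFSet.{0}) : Prop where
  iotaRelation : IsIotaRelation W (J2 : Set ZFSet.{0})
  wellOrders : WellOrders W (J2 : Set ZFSet.{0})
  initialSegment_isIotaSet : ∀ S : Set ZFSet.{0}, IsInitialSegment W S → IsIotaSet S
  exists_initialSegment : ∀ Y : Set ZFSet.{0}, IsIotaSet Y →
    ∃ S : Set ZFSet.{0}, IsInitialSegment W S ∧ Y ⊆ S

/-- The quotient `X / E`, formed by picking the `W`-least element of each block. -/
def quotient (W X E : Set ZFSet.{0}) : Set ZFSet.{0} :=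
  {a | a ∈ X ∧ ∀ b, b ∈ X ∧ ZFSet.pair a b ∈ E → ZFSet.pair a b ∈ W}

end AnalysisJ2

/-!
If a well-ordering `p` of a transitive set belongs to a rudimentarily closed set, then so does its
end extension by the sets `B(x, y) ∩ dom p`, for any binary rudimentary operation `B`, ordered by
their lexicographically least codes `(x, y)`. The rudimentary functions are generated, up to coding
of tuples, by finitely many binary operations, and each of these raises the level by a bounded
amount when the extension is iterated through all of them. So, starting from a well-ordering `p` of
`x ∪ {x}` in the rudimentary closure of `x`, finitely many iterations reach any given element of
that closure, and the union of the iterates well-orders it. The union is definable over the closure,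
since a finite chain of iterates is an element of it, and hence it is an element of the next
rudimentary closure. Doing this for `x = ∅` gives a well-ordering of `J₁ ∪ {J₁}` in `J₂`; doing it
again for `x = J₁` gives the universal well-ordering.

The quotient of an `ι`-set `X` is `X ∖ dom (∼ ∖ ⪯)`, restricted to `X × X`. For `a` in an initial
segment `S`, being least in its block is decided by `X ∩ S`, so the quotient of an `ι`-class meets
`S` in the quotient of the `ι`-set `X ∩ S`.
-/

namespace AnalysisJ2

open ZFSet (pair pair_inj)

local notation "V" => (ZFSet : Type 1)

/-! ### A calculus of rudimentary functions and relations -/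

/-- The union `⋃_{y ∈ x} H(y)`. -/
noncomputable def bUnion (x : V) (H : V → V) : V :=
  ZFSet.iUnion fun y : x => H y

@[simp]
theorem mem_bUnion {x t : V} {H : V → V} : t ∈ bUnion x H ↔ ∃ y ∈ x, t ∈ H y := by
  simp [bUnion]

/-- A rudimentary relation, in Jensen's sense: the non-vanishing of a rudimentary function. -/
def RudRel {n : ℕ} (P : (Fin n → V) → Prop) : Prop :=
  ∃ F : (Fin n → V) → V, Rudimentary F ∧ ∀ v, P v ↔ ∃ u, u ∈ F v

section Calculus

variable {n : ℕ} {f g h : (Fin n → V) → V} {P Q : (Fin n → V) → Prop}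

theorem Rudimentary.comp₂ {B : V → V → V} (hB : Rudimentary fun v : Fin 2 → V => B (v 0) (v 1))
    (hf : Rudimentary f) (hg : Rudimentary g) : Rudimentary fun v => B (f v) (g v) :=
  hB.comp (H := ![f, g]) (Fin.forall_fin_two.2 ⟨hf, hg⟩)

theorem Rudimentary.comp₃ {B : V → V → V → V}
    (hB : Rudimentary fun v : Fin 3 → V => B (v 0) (v 1) (v 2)) (hf : Rudimentary f)
    (hg : Rudimentary g) (hh : Rudimentary h) : Rudimentary fun v => B (f v) (g v) (h v) :=
  hB.comp (H := ![f, g, h]) (Fin.forall_fin_succ.2 ⟨hf, Fin.forall_fin_two.2 ⟨hg, hh⟩⟩)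

theorem Rudimentary.upair (hf : Rudimentary f) (hg : Rudimentary g) :
    Rudimentary fun v => {f v, g v} :=
  comp₂ (B := fun x y => {x, y}) (.pair 0 1) hf hg

theorem Rudimentary.sdiff (hf : Rudimentary f) (hg : Rudimentary g) :
    Rudimentary fun v => f v \ g v :=
  comp₂ (.diff 0 1) hf hg

theorem Rudimentary.bUnion {H : V → (Fin n → V) → V} (hf : Rudimentary f)
    (hH : Rudimentary fun w : Fin (n + 1) → V => H (w 0) (Fin.tail w)) :
    Rudimentary fun v => bUnion (f v) fun y => H y v := by
  have hcons : ∀ v : Fin n → V,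
      (fun i => (Fin.cons f (fun i v => v i) : Fin (n + 1) → (Fin n → V) → V) i v) =
        (Fin.cons (f v) v : Fin (n + 1) → V) :=
    fun v => funext (Fin.cases rfl fun _ => rfl)
  convert (union hH).comp (H := Fin.cons f fun i v => v i)
    (Fin.cases hf fun i => .proj i) using 2 with v
  rw [hcons v]
  simp only [Fin.update_cons_zero, Fin.cons_zero, Fin.tail_cons]
  rfl

theorem Rudimentary.singleton (hf : Rudimentary f) : Rudimentary fun v => {f v} := by
  simpa only [ZFSet.pair_eq_singleton] using hf.upair hf

theorem Rudimentary.opair (hf : Rudimentary f) (hg : Rudimentary g) :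
    Rudimentary fun v => ZFSet.pair (f v) (g v) :=
  hf.singleton.upair (hf.upair hg)

theorem Rudimentary.sUnion (hf : Rudimentary f) : Rudimentary fun v => ZFSet.sUnion (f v) := by
  convert hf.bUnion (H := fun y _ => y) (.proj 0) using 2 with v
  ext
  simp

theorem Rudimentary.union_fun (hf : Rudimentary f) (hg : Rudimentary g) :
    Rudimentary fun v => f v ∪ g v :=
  (hf.upair hg).sUnion

theorem Rudimentary.weaken (hf : Rudimentary f) :
    Rudimentary fun w : Fin (n + 1) → V => f (Fin.tail w) :=
  hf.comp (H := fun i w => Fin.tail w i) fun i => .proj i.succ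

theorem Rudimentary.inter (hf : Rudimentary f) (hg : Rudimentary g) :
    Rudimentary fun v => f v ∩ g v := by
  convert hf.sdiff (hf.sdiff hg) using 2 with v
  ext
  simp +contextual

theorem RudRel.nonempty (hf : Rudimentary f) : RudRel fun v => ∃ u, u ∈ f v :=
  ⟨f, hf, fun _ => Iff.rfl⟩

theorem RudRel.exists_rudimentary_cons {P : V → (Fin n → V) → Prop}
    (hP : RudRel fun w : Fin (n + 1) → V => P (w 0) (Fin.tail w)) :
    ∃ F : V → (Fin n → V) → V, Rudimentary (fun w : Fin (n + 1) → V => F (w 0) (Fin.tail w)) ∧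
      ∀ y v, P y v ↔ ∃ u, u ∈ F y v := by
  obtain ⟨F, hF, hPF⟩ := hP
  exact ⟨fun y v => F (Fin.cons y v), by simpa only [Fin.cons_self_tail] using hF,
    fun y v => by simpa using hPF (Fin.cons y v)⟩

theorem RudRel.bex {P : V → (Fin n → V) → Prop} (hf : Rudimentary f)
    (hP : RudRel fun w : Fin (n + 1) → V => P (w 0) (Fin.tail w)) :
    RudRel fun v => ∃ y ∈ f v, P y v := by
  obtain ⟨F, hF, hPF⟩ := hP.exists_rudimentary_cons
  refine ⟨_, hf.bUnion hF, fun v => ?_⟩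
  simp only [hPF, mem_bUnion]
  grind

theorem RudRel.not (hP : RudRel P) : RudRel fun v => ¬ P v := by
  obtain ⟨F, hF, hPF⟩ := hP
  refine ⟨_, hF.singleton.sdiff (hF.bUnion (H := fun _ v => {F v}) hF.singleton.weaken),
    fun v => ?_⟩
  simp [hPF]

theorem RudRel.or (hP : RudRel P) (hQ : RudRel Q) : RudRel fun v => P v ∨ Q v := by
  obtain ⟨F, hF, hPF⟩ := hP
  obtain ⟨G, hG, hQG⟩ := hQ
  exact ⟨_, hF.union_fun hG, fun v => by simp [hPF, hQG, exists_or]⟩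

theorem RudRel.and (hP : RudRel P) (hQ : RudRel Q) : RudRel fun v => P v ∧ Q v := by
  simpa using (hP.not.or hQ.not).not

theorem RudRel.imp (hP : RudRel P) (hQ : RudRel Q) : RudRel fun v => P v → Q v := by
  simpa only [imp_iff_not_or] using hP.not.or hQ

theorem RudRel.ball {P : V → (Fin n → V) → Prop} (hf : Rudimentary f)
    (hP : RudRel fun w : Fin (n + 1) → V => P (w 0) (Fin.tail w)) :
    RudRel fun v => ∀ y ∈ f v, P y v := by
  simpa using (RudRel.bex (P := fun y v => ¬ P y v) hf hP.not).not

theorem RudRel.mem (hf : Rudimentary f) (hg : Rudimentary g) : RudRel fun v => f v ∈ g v := by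
  simpa using (RudRel.nonempty (hf.singleton.sdiff hg)).not

theorem RudRel.eq (hf : Rudimentary f) (hg : Rudimentary g) : RudRel fun v => f v = g v := by
  simpa using RudRel.mem hf hg.singleton

theorem Rudimentary.sep {P : V → (Fin n → V) → Prop} (hf : Rudimentary f)
    (hP : RudRel fun w : Fin (n + 1) → V => P (w 0) (Fin.tail w)) :
    Rudimentary fun v => ZFSet.sep (fun y => P y v) (f v) := by
  obtain ⟨F, hF, hPF⟩ := hP.exists_rudimentary_cons
  -- The inner union over `F y v` is `{y}` or `∅` according to whether `P y v` holds.
  convert hf.bUnion (H := fun y v => AnalysisJ2.bUnion (F y v) fun _ => {y})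
    (hF.bUnion (H := fun _ w => {w 0}) (.singleton (.proj 1))) using 2 with v
  ext y
  simp only [ZFSet.mem_sep, mem_bUnion, ZFSet.mem_singleton, hPF]
  grind

end Calculus

section Closure

variable {J : V} (hJ : RudClosed J)
include hJ

theorem RudClosed.mem₁ {F : V → V} (hF : Rudimentary fun v : Fin 1 → V => F (v 0)) {x : V}
    (hx : x ∈ J) : F x ∈ J :=
  hJ hF ![x] (Fin.forall_fin_one.2 hx)

theorem RudClosed.mem₂ {F : V → V → V} (hF : Rudimentary fun v : Fin 2 → V => F (v 0) (v 1))
    {x y : V} (hx : x ∈ J) (hy : y ∈ J) : F x y ∈ J :=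
  hJ hF ![x, y] (Fin.forall_fin_two.2 ⟨hx, hy⟩)

end Closure

/-! ### Operations on binary relations -/

/-- The section `{u : ⟨x, u⟩ ∈ r}`. -/
noncomputable def sect (r x : V) : V :=
  ZFSet.sep (fun u => pair x u ∈ r) (ZFSet.sUnion (ZFSet.sUnion r))

/-- The domain of the set of ordered pairs contained in `r`. -/
noncomputable def dom (r : V) : V :=
  ZFSet.sep (fun x => ∃ u, u ∈ sect r x) (ZFSet.sUnion (ZFSet.sUnion r))

/-- The relation `{⟨x, w⟩ : w ∈ x ∈ a}`. -/
noncomputable def memRel (a : V) : V :=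
  bUnion a fun x => bUnion x fun w => {pair x w}

/-- The first projection on the ordered pairs in `a`. -/
noncomputable def fstRel (a : V) : V :=
  bUnion (dom a) fun u => bUnion (sect a u) fun v => {pair (pair u v) u}

/-- The second projection on the ordered pairs in `a`. -/
noncomputable def sndRel (a : V) : V :=
  bUnion (dom a) fun u => bUnion (sect a u) fun v => {pair (pair u v) v}

/-- The composition of relations, `r` being applied first. -/
noncomputable def compRel (r s : V) : V :=
  bUnion (dom r) fun x => bUnion (sect r x) fun u => bUnion (sect s u) fun w => {pair x w}

/-- The fork of relations: `x` is related to `⟨u, v⟩` if `⟨x, u⟩ ∈ r` and `⟨x, v⟩ ∈ s`. -/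
noncomputable def forkRel (r s : V) : V :=
  bUnion (dom r) fun x => bUnion (sect r x) fun u => bUnion (sect s x) fun v =>
    {pair x (pair u v)}

/-- The function on `a` that sends `x` to the section of `r` at `x`. -/
noncomputable def graphRel (r a : V) : V :=
  bUnion a fun x => {pair x (sect r x)}

theorem mem_sUnion_sUnion_of_pair_mem {r x u : V} (h : pair x u ∈ r) :
    x ∈ ZFSet.sUnion (ZFSet.sUnion r) ∧ u ∈ ZFSet.sUnion (ZFSet.sUnion r) := by
  have hxu : ({x, u} : V) ∈ ZFSet.sUnion r :=
    ZFSet.mem_sUnion_of_mem (ZFSet.mem_pair.2 (.inr rfl)) h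
  exact ⟨ZFSet.mem_sUnion_of_mem (by simp) hxu, ZFSet.mem_sUnion_of_mem (by simp) hxu⟩

section Mem

variable {a r s u w x : V}

@[simp]
theorem mem_sect : u ∈ sect r x ↔ pair x u ∈ r :=
  ZFSet.mem_sep.trans (and_iff_right_of_imp fun h => (mem_sUnion_sUnion_of_pair_mem h).2)

@[simp]
theorem mem_dom : x ∈ dom r ↔ ∃ u, pair x u ∈ r := by
  simp only [dom, ZFSet.mem_sep, mem_sect, and_iff_right_iff_imp]
  exact fun ⟨u, hu⟩ => (mem_sUnion_sUnion_of_pair_mem hu).1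

theorem pair_mem_memRel : pair x w ∈ memRel a ↔ x ∈ a ∧ w ∈ x := by
  simp only [memRel, mem_bUnion, ZFSet.mem_singleton, pair_inj]
  grind

theorem pair_mem_fstRel : pair x w ∈ fstRel a ↔ x ∈ a ∧ ∃ v, x = pair w v := by
  simp only [fstRel, mem_bUnion, mem_dom, mem_sect, ZFSet.mem_singleton, pair_inj]
  grind

theorem pair_mem_sndRel : pair x w ∈ sndRel a ↔ x ∈ a ∧ ∃ u, x = pair u w := by
  simp only [sndRel, mem_bUnion, mem_dom, mem_sect, ZFSet.mem_singleton, pair_inj]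
  grind

theorem pair_mem_compRel : pair x w ∈ compRel r s ↔ ∃ u, pair x u ∈ r ∧ pair u w ∈ s := by
  simp only [compRel, mem_bUnion, mem_dom, mem_sect, ZFSet.mem_singleton, pair_inj]
  grind

theorem pair_mem_forkRel :
    pair x w ∈ forkRel r s ↔ ∃ u v, w = pair u v ∧ pair x u ∈ r ∧ pair x v ∈ s := by
  simp only [forkRel, mem_bUnion, mem_dom, mem_sect, ZFSet.mem_singleton, pair_inj]
  grind

theorem pair_mem_graphRel : pair x w ∈ graphRel r a ↔ x ∈ a ∧ w = sect r x := by
  simp only [graphRel, mem_bUnion, ZFSet.mem_singleton, pair_inj]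
  grind

end Mem

theorem Rudimentary.sect {n : ℕ} {f g : (Fin n → V) → V} (hf : Rudimentary f)
    (hg : Rudimentary g) : Rudimentary fun v => sect (f v) (g v) :=
  hf.sUnion.sUnion.sep (P := fun u v => ZFSet.pair (g v) u ∈ f v)
    (.mem (.opair hg.weaken (.proj 0)) hf.weaken)

theorem Rudimentary.dom {n : ℕ} {f : (Fin n → V) → V} (hf : Rudimentary f) :
    Rudimentary fun v => dom (f v) :=
  hf.sUnion.sUnion.sep (P := fun x v => ∃ u, u ∈ AnalysisJ2.sect (f v) x)
    (.nonempty (.sect hf.weaken (.proj 0)))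

/-! ### The rudimentary functions are generated by finitely many operations -/

/-- Operations that generate the rudimentary functions, see `IsBasicClosed.mem_of_rudimentary`.
All of them are binary: some disregard their second argument. -/
noncomputable def basicOps : List (V → V → V) :=
  [fun x y => {x, y}, fun x y => x \ y, fun x _ => ZFSet.sUnion x, sect, fun x _ => memRel x,
    fun x _ => fstRel x, fun x _ => sndRel x, compRel, forkRel, graphRel]

theorem rudimentary_of_mem_basicOps {B : V → V → V} (hB : B ∈ basicOps) :
    Rudimentary fun v : Fin 2 → V => B (v 0) (v 1) := by
  simp only [basicOps, List.mem_cons, List.not_mem_nil, or_false] at hB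
  rcases hB with rfl | rfl | rfl | rfl | rfl | rfl | rfl | rfl | rfl | rfl
  · exact .pair 0 1
  · exact .diff 0 1
  · exact .sUnion (.proj 0)
  · exact .sect (.proj 0) (.proj 1)
  · exact .bUnion (.proj 0) (.bUnion (.proj 0) (.singleton (.opair (.proj 1) (.proj 0))))
  · exact .bUnion (.dom (.proj 0)) (.bUnion (.sect (.proj 1) (.proj 0))
      (.singleton (.opair (.opair (.proj 1) (.proj 0)) (.proj 1))))
  · exact .bUnion (.dom (.proj 0)) (.bUnion (.sect (.proj 1) (.proj 0))
      (.singleton (.opair (.opair (.proj 1) (.proj 0)) (.proj 0))))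
  · exact .bUnion (.dom (.proj 0)) (.bUnion (.sect (.proj 1) (.proj 0))
      (.bUnion (.sect (.proj 3) (.proj 0)) (.singleton (.opair (.proj 2) (.proj 0)))))
  · exact .bUnion (.dom (.proj 0)) (.bUnion (.sect (.proj 1) (.proj 0))
      (.bUnion (.sect (.proj 3) (.proj 1))
        (.singleton (.opair (.proj 2) (.opair (.proj 1) (.proj 0))))))
  · exact .bUnion (.proj 1) (.singleton (.opair (.proj 0) (.sect (.proj 1) (.proj 0))))

/-- Closure under the basic operations. -/
def IsBasicClosed (L : Set V) : Prop :=
  ∀ ⦃B : V → V → V⦄, B ∈ basicOps → ∀ ⦃x⦄, x ∈ L → ∀ ⦃y⦄, y ∈ L → B x y ∈ L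

/-- The relation `ρ` is represented in `L` on every `A ∈ L`; the representing set may also contain
sets that are not ordered pairs. -/
def IsLocal (L : Set V) (ρ : V → V → Prop) : Prop :=
  ∀ A ∈ L, ∃ r ∈ L, ∀ x w, pair x w ∈ r ↔ x ∈ A ∧ ρ x w

/-- The code `⟨v₀, ⟨v₁, …, ∅⟩⟩` of a tuple. -/
noncomputable def code : {n : ℕ} → (Fin n → V) → V
  | 0, _ => ∅
  | _ + 1, v => pair (v 0) (code (Fin.tail v))

/-- The graph of the function `F`, read as a relation between codes and sets, is local. -/
def IsLocalFun (L : Set V) {n : ℕ} (F : (Fin n → V) → V) : Prop :=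
  ∃ ρ, IsLocal L ρ ∧ ∀ v w, ρ (code v) w ↔ w = F v

namespace IsBasicClosed

variable {L : Set V} (hL : IsBasicClosed L) {ρ σ : V → V → Prop}
include hL

theorem upair_mem {x y : V} (hx : x ∈ L) (hy : y ∈ L) : {x, y} ∈ L :=
  hL (B := fun x y => {x, y}) (by simp [basicOps]) hx hy

theorem pair_mem {x y : V} (hx : x ∈ L) (hy : y ∈ L) : pair x y ∈ L :=
  hL.upair_mem (ZFSet.pair_eq_singleton x ▸ hL.upair_mem hx hx) (hL.upair_mem hx hy)

theorem sdiff_mem {x y : V} (hx : x ∈ L) (hy : y ∈ L) : x \ y ∈ L :=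
  hL (B := fun x y => x \ y) (by simp [basicOps]) hx hy

theorem sUnion_mem {x : V} (hx : x ∈ L) : ZFSet.sUnion x ∈ L :=
  hL (B := fun x _ => ZFSet.sUnion x) (by simp [basicOps]) hx hx

theorem sect_mem {r x : V} (hr : r ∈ L) (hx : x ∈ L) : sect r x ∈ L :=
  hL (by simp [basicOps]) hr hx

theorem isLocal_mem : IsLocal L fun x w => w ∈ x := fun _ hA =>
  ⟨_, hL (B := fun x _ => memRel x) (by simp [basicOps]) hA hA, fun _ _ => pair_mem_memRel⟩

theorem isLocal_fst : IsLocal L fun x w => ∃ v, x = pair w v := fun _ hA =>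
  ⟨_, hL (B := fun x _ => fstRel x) (by simp [basicOps]) hA hA, fun _ _ => pair_mem_fstRel⟩

theorem isLocal_snd : IsLocal L fun x w => ∃ u, x = pair u w := fun _ hA =>
  ⟨_, hL (B := fun x _ => sndRel x) (by simp [basicOps]) hA hA, fun _ _ => pair_mem_sndRel⟩

theorem isLocal_comp (hρ : IsLocal L ρ) (hσ : IsLocal L σ) :
    IsLocal L fun x w => ∃ u, ρ x u ∧ σ u w := by
  intro A hA
  obtain ⟨r, hr, hrρ⟩ := hρ A hA
  obtain ⟨s, hs, hsσ⟩ := hσ _ (hL.sUnion_mem (hL.sUnion_mem hr))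
  refine ⟨compRel r s, hL (by simp [basicOps]) hr hs, fun x w => ?_⟩
  rw [pair_mem_compRel]
  constructor
  · rintro ⟨u, hxu, huw⟩
    exact ⟨((hrρ x u).1 hxu).1, u, ((hrρ x u).1 hxu).2, ((hsσ u w).1 huw).2⟩
  · rintro ⟨hx, u, hxu, huw⟩
    have hxu' := (hrρ x u).2 ⟨hx, hxu⟩
    exact ⟨u, hxu', (hsσ u w).2 ⟨(mem_sUnion_sUnion_of_pair_mem hxu').2, huw⟩⟩

theorem isLocal_fork (hρ : IsLocal L ρ) (hσ : IsLocal L σ) :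
    IsLocal L fun x w => ∃ u v, w = pair u v ∧ ρ x u ∧ σ x v := by
  intro A hA
  obtain ⟨r, hr, hrρ⟩ := hρ A hA
  obtain ⟨s, hs, hsσ⟩ := hσ A hA
  refine ⟨forkRel r s, hL (by simp [basicOps]) hr hs, fun x w => ?_⟩
  simp only [pair_mem_forkRel, hrρ, hsσ]
  grind

theorem isLocal_diff (hρ : IsLocal L ρ) (hσ : IsLocal L σ) :
    IsLocal L fun x w => ρ x w ∧ ¬ σ x w := by
  intro A hA
  obtain ⟨r, hr, hrρ⟩ := hρ A hA
  obtain ⟨s, hs, hsσ⟩ := hσ A hA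
  refine ⟨r \ s, hL.sdiff_mem hr hs, fun x w => ?_⟩
  rw [ZFSet.mem_sdiff, hrρ, hsσ]
  tauto

theorem isLocal_or (hρ : IsLocal L ρ) (hσ : IsLocal L σ) :
    IsLocal L fun x w => ρ x w ∨ σ x w := by
  intro A hA
  obtain ⟨r, hr, hrρ⟩ := hρ A hA
  obtain ⟨s, hs, hsσ⟩ := hσ A hA
  refine ⟨r ∪ s, hL.sUnion_mem (hL.upair_mem hr hs), fun x w => ?_⟩
  rw [ZFSet.mem_union, hrρ, hsσ, and_or_left]

theorem isLocal_eq_setOf (hρ : IsLocal L ρ) : IsLocal L fun x w => ∀ u, u ∈ w ↔ ρ x u := by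
  intro A hA
  obtain ⟨r, hr, hrρ⟩ := hρ A hA
  refine ⟨graphRel r A, hL (by simp [basicOps]) hr hA, fun x w => ?_⟩
  rw [pair_mem_graphRel, ZFSet.ext_iff]
  simp only [mem_sect, hrρ]
  grind

theorem isLocalFun_of_mem {n : ℕ} {F : (Fin n → V) → V} (hρ : IsLocal L ρ)
    (hρF : ∀ v w, ρ (code v) w ↔ w ∈ F v) : IsLocalFun L F :=
  ⟨_, hL.isLocal_eq_setOf hρ, fun v w => by simp only [hρF, ZFSet.ext_iff]⟩

theorem exists_isLocal_mem {n : ℕ} {F : (Fin n → V) → V} (hF : IsLocalFun L F) :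
    ∃ ρ, IsLocal L ρ ∧ ∀ v w, ρ (code v) w ↔ w ∈ F v := by
  obtain ⟨ρ, hρ, hρF⟩ := hF
  exact ⟨_, hL.isLocal_comp hρ hL.isLocal_mem, fun v w => by simp [hρF]⟩

theorem isLocalFun_proj {n : ℕ} (i : Fin n) : IsLocalFun L fun v => v i := by
  induction n with
  | zero => exact i.elim0
  | succ n ih =>
    cases i using Fin.cases with
    | zero =>
      refine ⟨_, hL.isLocal_fst, fun v w => ?_⟩
      simp [code, pair_inj, eq_comm]
    | succ i =>
      obtain ⟨ρ, hρ, hρi⟩ := ih i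
      refine ⟨_, hL.isLocal_comp hL.isLocal_snd hρ, fun v w => ?_⟩
      simp [code, pair_inj, hρi, Fin.tail]

theorem isLocalFun_code {n k : ℕ} {H : Fin k → (Fin n → V) → V}
    (hH : ∀ i, IsLocalFun L (H i)) : IsLocalFun L fun v => code fun i => H i v := by
  induction k with
  | zero =>
    exact hL.isLocalFun_of_mem (hL.isLocal_diff hL.isLocal_mem hL.isLocal_mem) fun v w => by
      simp [code]
  | succ k ih =>
    obtain ⟨ρ, hρ, hρH⟩ := hH 0
    obtain ⟨σ, hσ, hσH⟩ := ih fun i => hH i.succ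
    refine ⟨_, hL.isLocal_fork hρ hσ, fun v w => ?_⟩
    simp only [hρH, hσH, code]
    simp [Fin.tail_def]

theorem isLocalFun_union {n : ℕ} {H : (Fin (n + 1) → V) → V} (hH : IsLocalFun L H) :
    IsLocalFun L fun v => ZFSet.iUnion fun y : v 0 => H (Function.update v 0 y) := by
  obtain ⟨ρ, hρ, hρH⟩ := hL.exists_isLocal_mem hH
  have hρH' : ∀ y (v : Fin (n + 1) → V) w,
      ρ (pair y (code (Fin.tail v))) w ↔ w ∈ H (Function.update v 0 y) := fun y v w => by
    rw [← hρH]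
    simp [code]
  -- `code v` is related to `code (update v 0 y)` for `y ∈ v 0`, and that is related to `w`.
  refine hL.isLocalFun_of_mem (hL.isLocal_comp (hL.isLocal_fork
    (hL.isLocal_comp hL.isLocal_fst hL.isLocal_mem) hL.isLocal_snd) hρ) fun v w => ?_
  simp only [code, pair_inj, ZFSet.mem_iUnion, Subtype.exists]
  grind

theorem isLocalFun {n : ℕ} {F : (Fin n → V) → V} (hF : Rudimentary F) : IsLocalFun L F := by
  induction hF with
  | proj i => exact hL.isLocalFun_proj i
  | pair i j =>
    obtain ⟨ρ, hρ, hρi⟩ := hL.isLocalFun_proj i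
    obtain ⟨σ, hσ, hσj⟩ := hL.isLocalFun_proj j
    exact hL.isLocalFun_of_mem (hL.isLocal_or hρ hσ) fun v w => by simp [hρi, hσj]
  | diff i j =>
    obtain ⟨ρ, hρ, hρi⟩ := hL.exists_isLocal_mem (hL.isLocalFun_proj i)
    obtain ⟨σ, hσ, hσj⟩ := hL.exists_isLocal_mem (hL.isLocalFun_proj j)
    exact hL.isLocalFun_of_mem (hL.isLocal_diff hρ hσ) fun v w => by simp [hρi, hσj]
  | comp _ _ ihG ihH =>
    obtain ⟨ρ, hρ, hρG⟩ := ihG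
    obtain ⟨σ, hσ, hσH⟩ := hL.isLocalFun_code ihH
    exact ⟨_, hL.isLocal_comp hσ hρ, fun v w => by simp [hρG, hσH]⟩
  | union _ ih => exact hL.isLocalFun_union ih

theorem code_mem (hne : L.Nonempty) {n : ℕ} {v : Fin n → V} (hv : ∀ i, v i ∈ L) :
    code v ∈ L := by
  induction n with
  | zero =>
    obtain ⟨x, hx⟩ := hne
    have hempty : x \ x = ∅ := by ext; simp
    rw [code, ← hempty]
    exact hL.sdiff_mem hx hx
  | succ n ih => exact hL.pair_mem (hv 0) (ih fun i => hv i.succ)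

theorem mem_of_rudimentary (hne : L.Nonempty) {n : ℕ} {F : (Fin n → V) → V}
    (hF : Rudimentary F) {v : Fin n → V} (hv : ∀ i, v i ∈ L) : F v ∈ L := by
  obtain ⟨ρ, hρ, hρF⟩ := hL.isLocalFun hF
  have hc := hL.code_mem hne hv
  obtain ⟨r, hr, hrρ⟩ := hρ {code v} (ZFSet.pair_eq_singleton (code v) ▸ hL.upair_mem hc hc)
  have hsect : sect r (code v) = {F v} := by
    ext w
    simp [hrρ, hρF]
  simpa [hsect] using hL.sUnion_mem (hL.sect_mem hr hc)

theorem mem_of_mem_rudClosure {x z : V} (hx : x ∈ L) (hxL : ∀ y ∈ x, y ∈ L)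
    (hz : z ∈ rudClosure x) : z ∈ L := by
  replace hz := mem_rudClosure.1 hz
  induction hz with
  | mem hz => exact hxL _ hz
  | self => exact hx
  | app hF _ _ ih => exact hL.mem_of_rudimentary ⟨x, hx⟩ hF ih

end IsBasicClosed

/-! ### Rudimentary closures of transitive sets -/

theorem rudClosed_rudClosure (x : V) : RudClosed (rudClosure x) :=
  (isLeast_rudClosure x).1.2.2

theorem subset_rudClosure (x : V) : x ⊆ rudClosure x :=
  (isLeast_rudClosure x).1.1

theorem self_mem_rudClosure (x : V) : x ∈ rudClosure x :=
  (isLeast_rudClosure x).1.2.1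

/-- The transitive closure of `z` (including `z` itself) is contained in `J`. -/
def HereditarilyIn (J z : V) : Prop :=
  ∀ ⦃y⦄, Relation.ReflTransGen (· ∈ ·) y z → y ∈ J

theorem hereditarilyIn_iff {J z : V} :
    HereditarilyIn J z ↔ z ∈ J ∧ ∀ y ∈ z, HereditarilyIn J y := by
  refine ⟨fun h => ⟨h .refl, fun y hy t ht => h (ht.tail hy)⟩, fun ⟨hz, h⟩ t ht => ?_⟩
  rcases ht.cases_tail with rfl | ⟨y, hty, hy⟩
  · exact hz
  · exact h y hy hty

theorem Rudimentary.hereditarilyIn {J : V} (hJ : RudClosed J) {n : ℕ} {F : (Fin n → V) → V}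
    (hF : Rudimentary F) {v : Fin n → V} (hv : ∀ i, HereditarilyIn J (v i)) :
    HereditarilyIn J (F v) := by
  have hmem : ∀ {m} {G : (Fin m → V) → V} {w : Fin m → V}, Rudimentary G →
      (∀ i, HereditarilyIn J (w i)) → G w ∈ J :=
    fun hG hw => hJ hG _ fun i => hw i .refl
  induction hF with
  | proj i => exact hv i
  | pair i j =>
    refine hereditarilyIn_iff.2 ⟨hmem (.pair i j) hv, fun y hy => ?_⟩
    rcases ZFSet.mem_pair.1 hy with rfl | rfl
    exacts [hv i, hv j]
  | diff i j =>
    exact hereditarilyIn_iff.2 ⟨hmem (.diff i j) hv, fun y hy =>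
      (hereditarilyIn_iff.1 (hv i)).2 y (ZFSet.mem_sdiff.1 hy).1⟩
  | comp _ _ ihG ihH => exact ihG fun i => ihH i hv
  | @union n H hH ih =>
    refine hereditarilyIn_iff.2 ⟨hmem (.union hH) hv, fun t ht => ?_⟩
    obtain ⟨y, ht⟩ := ZFSet.mem_iUnion.1 ht
    refine (hereditarilyIn_iff.1 (ih fun i => ?_)).2 t ht
    cases i using Fin.cases with
    | zero => simpa using (hereditarilyIn_iff.1 (hv 0)).2 y y.2
    | succ i => simpa using hv i.succ

theorem isTransitive_rudClosure {x : V} (hx : x.IsTransitive) : (rudClosure x).IsTransitive := by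
  have hmem : ∀ z ∈ x, HereditarilyIn (rudClosure x) z := fun z hz y hyz =>
    subset_rudClosure x (hyz.head_induction_on hz fun hab _ hb => hx.mem_trans hab hb)
  suffices h : ∀ z, RudGenerated x z → HereditarilyIn (rudClosure x) z from
    fun z hz y hy => h z (mem_rudClosure.1 hz) (.single hy)
  intro z hz
  induction hz with
  | mem hz => exact hmem _ hz
  | self => exact hereditarilyIn_iff.2 ⟨self_mem_rudClosure x, hmem⟩
  | app hF _ _ ih => exact hF.hereditarilyIn (rudClosed_rudClosure x) ih

theorem isTransitive_J1 : J1.IsTransitive :=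
  isTransitive_rudClosure ZFSet.isTransitive_empty

theorem isTransitive_J2 : J2.IsTransitive :=
  isTransitive_rudClosure isTransitive_J1

/-! ### End extensions of well-orderings -/

section WellOrders

variable {W X : Set V}

theorem WellOrders.of_injOn {ι : Type*} [LinearOrder ι] [WellFoundedLT ι] {f : V → ι}
    (hf : X.InjOn f) (hW : ∀ a ∈ X, ∀ b ∈ X, pair a b ∈ W ↔ f a ≤ f b) : WellOrders W X where
  refl a ha := (hW a ha a ha).2 le_rfl
  antisymm a ha b hb hab hba := hf ha hb (((hW a ha b hb).1 hab).antisymm ((hW b hb a ha).1 hba))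
  trans a ha b hb c hc hab hbc :=
    (hW a ha c hc).2 (((hW a ha b hb).1 hab).trans ((hW b hb c hc).1 hbc))
  total a ha b hb := by
    rw [hW a ha b hb, hW b hb a ha]
    exact le_total _ _
  exists_least S hS hne := by
    obtain ⟨a, ha, hmin⟩ := (InvImage.wf f wellFounded_lt).has_min S hne
    exact ⟨a, ha, fun b hb => (hW a (hS ha) b (hS hb)).2 (not_lt.1 (hmin b hb))⟩

theorem WellOrders.exists_injOn_ordinal (h : WellOrders W X) :
    ∃ f : V → Ordinal.{1}, X.InjOn f ∧ ∀ a ∈ X, ∀ b ∈ X, pair a b ∈ W ↔ f a ≤ f b := by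
  classical
  let r : X → X → Prop := fun a b => pair (b : V) a ∉ W
  have hr : IsWellOrder X r :=
    { trichotomous := fun a b hab hba => Subtype.ext
        (h.antisymm a a.2 b b.2 (not_not.1 hba) (not_not.1 hab))
      wf := WellFounded.wellFounded_iff_has_min.2 fun s hs => by
        obtain ⟨_, ⟨a, ha, rfl⟩, hmin⟩ :=
          h.exists_least (Subtype.val '' s) (by simp) (hs.image _)
        exact ⟨a, ha, fun b hb => not_not.2 (hmin b ⟨b, hb, rfl⟩)⟩ }
  refine ⟨fun a => if ha : a ∈ X then Ordinal.typein r ⟨a, ha⟩ else 0, ?_, ?_⟩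
  · intro a ha b hb hab
    simpa [ha, hb] using hab
  · intro a ha b hb
    simp [ha, hb, r]

end WellOrders

section Extension

variable {B : V → V → V} {W : V}

/-- The sets `B(x, y) ∩ A` for `x, y ∈ A`. -/
noncomputable def newSets (B : V → V → V) (A : V) : V :=
  bUnion A fun x => bUnion A fun y => {B x y ∩ A}

/-- The lexicographic order on pairs that is induced by the ordering `W`. -/
def LexLE (W x y x' y' : V) : Prop :=
  pair x x' ∈ W ∧ (x = x' → pair y y' ∈ W)

/-- A code of `z` is a pair `(x, y)` with `B(x, y) ∩ dom W = z`; the lexicographically least code of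
`z` is at most that of `z'`. -/
def LeastCodeLE (B : V → V → V) (W z z' : V) : Prop :=
  ∃ x ∈ dom W, ∃ y ∈ dom W, B x y ∩ dom W = z ∧
    ∀ x' ∈ dom W, ∀ y' ∈ dom W, B x' y' ∩ dom W = z' → LexLE W x y x' y'

/-- The order on `dom W ∪ newSets B (dom W)` in which the elements of `dom W` come first and the
other ones are compared by their least codes. -/
def ExtensionLE (B : V → V → V) (W z z' : V) : Prop :=
  (z ∈ dom W ∧ (z' ∈ dom W → pair z z' ∈ W)) ∨
    (z ∉ dom W ∧ z' ∉ dom W ∧ LeastCodeLE B W z z')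

/-- The end extension of the well-ordering `W` by the sets `B(x, y) ∩ dom W` for
`x, y ∈ dom W`. -/
noncomputable def extension (B : V → V → V) (W : V) : V :=
  bUnion (dom W ∪ newSets B (dom W)) fun z =>
    bUnion (ZFSet.sep (ExtensionLE B W z) (dom W ∪ newSets B (dom W))) fun z' => {pair z z'}

theorem mem_newSets {A z : V} : z ∈ newSets B A ↔ ∃ x ∈ A, ∃ y ∈ A, B x y ∩ A = z := by
  simp [newSets, eq_comm]

theorem pair_mem_extension {z z' : V} : pair z z' ∈ extension B W ↔
    z ∈ dom W ∪ newSets B (dom W) ∧ z' ∈ dom W ∪ newSets B (dom W) ∧ ExtensionLE B W z z' := by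
  simp only [extension, mem_bUnion, ZFSet.mem_sep, ZFSet.mem_singleton, pair_inj]
  grind

theorem WellOrders.exists_injOn_leastCodeLE (h : WellOrders (W : Set V) (dom W : Set V)) :
    ∃ m : V → Ordinal.{1} ×ₗ Ordinal.{1}, Set.InjOn m (newSets B (dom W) : Set V) ∧
      ∀ z ∈ newSets B (dom W), ∀ z' ∈ newSets B (dom W),
        LeastCodeLE B W z z' ↔ m z ≤ m z' := by
  obtain ⟨g, hg, hgW⟩ := h.exists_injOn_ordinal
  have hlex : ∀ x ∈ dom W, ∀ y ∈ dom W, ∀ x' ∈ dom W, ∀ y' ∈ dom W,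
      LexLE W x y x' y' ↔ toLex (g x, g y) ≤ toLex (g x', g y') := by
    intro x hx y hy x' hx' y' hy'
    have hxx' := hgW x hx x' hx'
    have hyy' := hgW y hy y' hy'
    rw [SetLike.mem_coe] at hxx' hyy'
    rw [Prod.Lex.toLex_le_toLex', LexLE, hxx', hyy', hg.eq_iff hx hx']
  let codes : V → Set (Ordinal.{1} ×ₗ Ordinal.{1}) := fun z =>
    {c | ∃ x ∈ dom W, ∃ y ∈ dom W, B x y ∩ dom W = z ∧ toLex (g x, g y) = c}
  have hleast : ∀ z ∈ newSets B (dom W), ∃ m, IsLeast (codes z) m := by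
    intro z hz
    obtain ⟨x, hx, y, hy, hxy⟩ := mem_newSets.1 hz
    obtain ⟨m, hm, hmin⟩ := wellFounded_lt.has_min (codes z) ⟨_, x, hx, y, hy, hxy, rfl⟩
    exact ⟨m, hm, fun c hc => not_lt.1 (hmin c hc)⟩
  choose! m hm using hleast
  refine ⟨m, fun z hz z' hz' hzz' => ?_, fun z hz z' hz' => ⟨?_, fun hzz' => ?_⟩⟩
  · obtain ⟨x, hx, y, hy, rfl, hxy⟩ := (hm z hz).1
    obtain ⟨x', hx', y', hy', rfl, hxy'⟩ := (hm z' hz').1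
    obtain ⟨hgx, hgy⟩ := Prod.mk.inj (toLex.injective ((hxy.trans hzz').trans hxy'.symm))
    rw [hg hx hx' hgx, hg hy hy' hgy]
  · rintro ⟨x, hx, y, hy, hxy, hle⟩
    obtain ⟨x', hx', y', hy', hxy', hm'⟩ := (hm z' hz').1
    rw [← hm']
    exact ((hm z hz).2 ⟨x, hx, y, hy, hxy, rfl⟩).trans
      ((hlex x hx y hy x' hx' y' hy').1 (hle x' hx' y' hy' hxy'))
  · obtain ⟨x, hx, y, hy, hxy, hmz⟩ := (hm z hz).1
    refine ⟨x, hx, y, hy, hxy, fun x' hx' y' hy' hxy' => (hlex x hx y hy x' hx' y' hy').2 ?_⟩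
    rw [hmz]
    exact hzz'.trans ((hm z' hz').2 ⟨x', hx', y', hy', hxy', rfl⟩)

theorem WellOrders.extension (h : WellOrders (W : Set V) (dom W : Set V)) :
    WellOrders (extension B W : Set V) (dom W ∪ newSets B (dom W) : V) := by
  classical
  obtain ⟨g, hg, hgW⟩ := h.exists_injOn_ordinal
  obtain ⟨m, hm, hmW⟩ := h.exists_injOn_leastCodeLE (B := B)
  have : WellFoundedLT (Ordinal.{1} ⊕ₗ (Ordinal.{1} ×ₗ Ordinal.{1})) :=
    ⟨Sum.lex_wf wellFounded_lt wellFounded_lt⟩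
  let f : V → Ordinal.{1} ⊕ₗ (Ordinal.{1} ×ₗ Ordinal.{1}) := fun z =>
    if z ∈ dom W then Sum.inlₗ (g z) else Sum.inrₗ (m z)
  have hnew : ∀ z ∈ dom W ∪ newSets B (dom W), z ∉ dom W → z ∈ newSets B (dom W) :=
    fun z hz => (ZFSet.mem_union.1 hz).resolve_left
  refine WellOrders.of_injOn (f := f) (fun z hz z' hz' hzz' => ?_) fun z hz z' hz' => ?_
  · by_cases hzW : z ∈ dom W <;> by_cases hzW' : z' ∈ dom W <;>
      simp only [f, hzW, hzW', if_true, if_false] at hzz'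
    · exact hg hzW hzW' (Sum.inl_injective (toLex.injective hzz'))
    · cases toLex.injective hzz'
    · cases toLex.injective hzz'
    · exact hm (hnew z hz hzW) (hnew z' hz' hzW') (Sum.inr_injective (toLex.injective hzz'))
  · rw [SetLike.mem_coe] at hz hz' ⊢
    rw [pair_mem_extension, and_iff_right hz, and_iff_right hz', ExtensionLE]
    by_cases hzW : z ∈ dom W <;> by_cases hzW' : z' ∈ dom W
    · simpa [-mem_dom, f, hzW, hzW'] using hgW z hzW z' hzW'
    · simp [-mem_dom, f, hzW, hzW']
    · simp [-mem_dom, f, hzW, hzW']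
    · simpa [-mem_dom, f, hzW, hzW'] using hmW z (hnew z hz hzW) z' (hnew z' hz' hzW')

/-- `W` is a well-ordering of its domain, which is a nonempty transitive set. -/
structure IsTransWellOrder (W : V) : Prop where
  pairs : ∀ z ∈ W, ∃ a ∈ dom W, ∃ b ∈ dom W, z = pair a b
  wellOrders : WellOrders (W : Set V) (dom W : Set V)
  isTransitive : (dom W).IsTransitive
  nonempty : ∃ a, a ∈ dom W

/-- The relation `U` end-extends the relation `W`. -/
structure EndExtends (U W : V) : Prop where
  subset : W ⊆ U
  pair_mem : ∀ ⦃a b⦄, b ∈ dom W → pair a b ∈ U → pair a b ∈ W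

theorem EndExtends.refl (W : V) : EndExtends W W :=
  ⟨fun _ h => h, fun _ _ _ h => h⟩

theorem EndExtends.dom_subset {U W : V} (h : EndExtends U W) : dom W ⊆ dom U := fun a ha => by
  obtain ⟨u, hu⟩ := mem_dom.1 ha
  exact mem_dom.2 ⟨u, h.subset hu⟩

theorem EndExtends.trans {U W W' : V} (h : EndExtends U W) (h' : EndExtends W W') :
    EndExtends U W' :=
  ⟨fun _ hz => h.subset (h'.subset hz),
    fun _ _ hb hab => h'.pair_mem hb (h.pair_mem (h'.dom_subset hb) hab)⟩

namespace IsTransWellOrder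

variable (hW : IsTransWellOrder W)
include hW

theorem dom_extension : dom (extension B W) = dom W ∪ newSets B (dom W) := by
  ext a
  rw [mem_dom]
  exact ⟨fun ⟨u, hu⟩ => (pair_mem_extension.1 hu).1,
    fun ha => ⟨a, hW.wellOrders.extension.refl a ha⟩⟩

theorem endExtends_extension : EndExtends (extension B W) W where
  subset z hz := by
    obtain ⟨a, ha, b, hb, rfl⟩ := hW.pairs z hz
    exact pair_mem_extension.2
      ⟨ZFSet.mem_union.2 (.inl ha), ZFSet.mem_union.2 (.inl hb), .inl ⟨ha, fun _ => hz⟩⟩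
  pair_mem a b hb hab := by
    rcases (pair_mem_extension.1 hab).2.2 with ⟨-, h⟩ | ⟨-, hb', -⟩
    exacts [h hb, absurd hb hb']

theorem isTransWellOrder_extension : IsTransWellOrder (extension B W) where
  pairs z hz := by
    simp only [extension, mem_bUnion, ZFSet.mem_sep, ZFSet.mem_singleton] at hz
    obtain ⟨a, ha, b, ⟨hb, -⟩, rfl⟩ := hz
    rw [hW.dom_extension]
    exact ⟨a, ha, b, hb, rfl⟩
  wellOrders := by
    rw [hW.dom_extension]
    exact hW.wellOrders.extension
  isTransitive := by
    rw [hW.dom_extension]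
    intro y hy t ht
    refine ZFSet.mem_union.2 (.inl ?_)
    rcases ZFSet.mem_union.1 hy with hy | hy
    · exact hW.isTransitive y hy ht
    · obtain ⟨a, -, b, -, rfl⟩ := mem_newSets.1 hy
      exact (ZFSet.mem_inter.1 ht).2
  nonempty := hW.nonempty.imp fun _ ha => hW.endExtends_extension.dom_subset ha

theorem mem_dom_extension {x y : V} (hx : x ∈ dom W) (hy : y ∈ dom W) (hxy : B x y ⊆ dom W) :
    B x y ∈ dom (extension B W) := by
  rw [hW.dom_extension, ZFSet.mem_union, mem_newSets]
  exact .inr ⟨x, hx, y, hy, by ext t; simpa using @hxy t⟩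

end IsTransWellOrder

end Extension

section Rudimentary

variable {B : V → V → V → V} (hB : Rudimentary fun v : Fin 3 → V => B (v 0) (v 1) (v 2)) {n : ℕ}
  {c f z z' : (Fin n → V) → V} (hc : Rudimentary c) (hf : Rudimentary f)

include hB hc hf

theorem RudRel.leastCodeLE (hz : Rudimentary z) (hz' : Rudimentary z') :
    RudRel fun v => LeastCodeLE (B (c v)) (f v) (z v) (z' v) := by
  have hval : ∀ {m} {c' f' x y : (Fin m → V) → V}, Rudimentary c' → Rudimentary f' →
      Rudimentary x → Rudimentary y →
      Rudimentary fun w => B (c' w) (x w) (y w) ∩ dom (f' w) :=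
    fun hc' hf' hx hy => (hB.comp₃ hc' hx hy).inter hf'.dom
  have hc₂ := hc.weaken.weaken
  have hf₂ := hf.weaken.weaken
  have hf₄ := hf₂.weaken.weaken
  exact .bex hf.dom (.bex hf.dom.weaken (.and
    (.eq (hval hc₂ hf₂ (.proj 1) (.proj 0)) hz.weaken.weaken)
    (.ball hf₂.dom (.ball hf₂.dom.weaken (.imp
      (.eq (hval hc₂.weaken.weaken hf₄ (.proj 1) (.proj 0)) hz'.weaken.weaken.weaken.weaken)
      (.and (.mem (.opair (.proj 3) (.proj 1)) hf₄)
        (.imp (.eq (.proj 3) (.proj 1)) (.mem (.opair (.proj 2) (.proj 0)) hf₄))))))))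

theorem RudRel.extensionLE (hz : Rudimentary z) (hz' : Rudimentary z') :
    RudRel fun v => ExtensionLE (B (c v)) (f v) (z v) (z' v) :=
  .or (.and (.mem hz hf.dom) (.imp (.mem hz' hf.dom) (.mem (.opair hz hz') hf)))
    (.and (.not (.mem hz hf.dom)) (.and (.not (.mem hz' hf.dom)) (.leastCodeLE hB hc hf hz hz')))

theorem Rudimentary.extension : Rudimentary fun v => extension (B (c v)) (f v) := by
  have hdom : Rudimentary fun v =>
      AnalysisJ2.dom (f v) ∪ newSets (B (c v)) (AnalysisJ2.dom (f v)) :=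
    hf.dom.union_fun (.bUnion hf.dom (.bUnion hf.dom.weaken (.singleton
      (.inter (hB.comp₃ hc.weaken.weaken (.proj 1) (.proj 0)) hf.dom.weaken.weaken))))
  exact .bUnion hdom (.bUnion
    (.sep hdom.weaken (.extensionLE hB hc.weaken.weaken hf.weaken.weaken (.proj 1) (.proj 0)))
    (.singleton (.opair (.proj 1) (.proj 0))))

end Rudimentary

/-- Successive end extensions by the operations in the list `l`. -/
noncomputable def extendBy (l : List (V → V → V)) (W : V) : V :=
  l.foldl (fun U B => extension B U) W

/-- The end extension of `W` by the set `dom W` and by the values of the basic operations. -/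
noncomputable def step (W : V) : V :=
  extendBy basicOps (extension (fun _ _ => dom W) W)

theorem Rudimentary.extendBy {l : List (V → V → V)}
    (hl : ∀ B ∈ l, Rudimentary fun v : Fin 2 → V => B (v 0) (v 1)) {n : ℕ} {f : (Fin n → V) → V}
    (hf : Rudimentary f) : Rudimentary fun v => extendBy l (f v) := by
  induction l generalizing f with
  | nil => exact hf
  | cons B l ih =>
    rw [List.forall_mem_cons] at hl
    exact ih hl.2
      (.extension (B := fun _ => B) (hl.1.comp₂ (.proj 1) (.proj 2)) hf hf)

theorem Rudimentary.extension_dom {n : ℕ} {f : (Fin n → V) → V} (hf : Rudimentary f) :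
    Rudimentary fun v => AnalysisJ2.extension (fun _ _ => AnalysisJ2.dom (f v)) (f v) :=
  .extension (B := fun A _ _ => A) (.proj 0) hf.dom hf

theorem Rudimentary.step {n : ℕ} {f : (Fin n → V) → V} (hf : Rudimentary f) :
    Rudimentary fun v => step (f v) :=
  hf.extension_dom.extendBy fun _ hB => rudimentary_of_mem_basicOps hB

namespace IsTransWellOrder

variable {W : V} (hW : IsTransWellOrder W)
include hW

theorem isTransWellOrder_extendBy (l : List (V → V → V)) :
    IsTransWellOrder (extendBy l W) := by
  induction l generalizing W with
  | nil => exact hW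
  | cons B _ ih => exact ih hW.isTransWellOrder_extension

theorem endExtends_extendBy (l : List (V → V → V)) : EndExtends (extendBy l W) W := by
  induction l generalizing W with
  | nil => exact .refl W
  | cons B l ih => exact (ih hW.isTransWellOrder_extension).trans hW.endExtends_extension

theorem mem_dom_extendBy {l : List (V → V → V)} {B : V → V → V} (hB : B ∈ l) {x y : V}
    (hx : x ∈ dom W) (hy : y ∈ dom W) (hxy : B x y ⊆ dom W) : B x y ∈ dom (extendBy l W) := by
  induction l generalizing W with
  | nil => simp at hB
  | cons C l ih =>
    have hext : EndExtends (extension C W) W := hW.endExtends_extension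
    rcases List.mem_cons.1 hB with rfl | hB
    · exact (hW.isTransWellOrder_extension.endExtends_extendBy l).dom_subset
        (hW.mem_dom_extension hx hy hxy)
    · exact ih hW.isTransWellOrder_extension hB (hext.dom_subset hx) (hext.dom_subset hy)
        fun _ ht => hext.dom_subset (hxy ht)

theorem dom_extension_dom : dom (extension (fun _ _ => dom W) W) = insert (dom W) (dom W) := by
  obtain ⟨a, ha⟩ := hW.nonempty
  have hself : dom W ∩ dom W = dom W := by ext; simp
  ext z
  rw [hW.dom_extension, ZFSet.mem_union, mem_newSets, ZFSet.mem_insert_iff, or_comm, hself]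
  grind

theorem isTransWellOrder_step : IsTransWellOrder (step W) :=
  hW.isTransWellOrder_extension.isTransWellOrder_extendBy _

theorem endExtends_step : EndExtends (step W) W :=
  (hW.isTransWellOrder_extension.endExtends_extendBy _).trans hW.endExtends_extension

theorem dom_mem_dom_step : dom W ∈ dom (step W) :=
  (hW.isTransWellOrder_extension.endExtends_extendBy _).dom_subset
    (hW.dom_extension_dom ▸ ZFSet.mem_insert _ _)

theorem mem_dom_step {B : V → V → V} (hB : B ∈ basicOps) {x y : V} (hx : x ∈ dom W)
    (hy : y ∈ dom W) (hxy : B x y ⊆ dom W) : B x y ∈ dom (step W) :=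
  have hext := hW.endExtends_extension.dom_subset
  hW.isTransWellOrder_extension.mem_dom_extendBy hB (hext hx) (hext hy) fun _ ht => hext (hxy ht)

end IsTransWellOrder

/-! ### The tower of end extensions -/

/-- The iterated end extensions of `p`. -/
noncomputable def tower (p : V) (n : ℕ) : V :=
  step^[n] p

/-- The domains of the iterated end extensions of `p`. -/
noncomputable def level (p : V) (n : ℕ) : V :=
  dom (tower p n)

/-- The union of the iterated end extensions of `p`. -/
def towerUnion (p : V) : Set V :=
  {z | ∃ n, z ∈ tower p n}

/-- The union of the domains of the iterated end extensions of `p`. -/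
def levelUnion (p : V) : Set V :=
  {z | ∃ n, z ∈ level p n}

theorem tower_succ (p : V) (n : ℕ) : tower p (n + 1) = step (tower p n) :=
  Function.iterate_succ_apply' step n p

theorem mem_of_pair_mem {A a b : V} (hA : A.IsTransitive) (h : pair a b ∈ A) :
    a ∈ A ∧ b ∈ A := by
  have hsub : ZFSet.sUnion (ZFSet.sUnion A) ⊆ A := fun t ht => by
    obtain ⟨y, hy, ht⟩ := ZFSet.mem_sUnion.1 ht
    obtain ⟨z, hz, hy⟩ := ZFSet.mem_sUnion.1 hy
    exact hA.mem_trans ht (hA.mem_trans hy hz)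
  exact (mem_sUnion_sUnion_of_pair_mem h).imp (@hsub _) (@hsub _)

namespace IsTransWellOrder

variable {p : V} (hp : IsTransWellOrder p) {m n : ℕ} {a b x y : V}
include hp

theorem isTransWellOrder_tower (n : ℕ) : IsTransWellOrder (tower p n) := by
  induction n with
  | zero => exact hp
  | succ n ih => exact tower_succ p n ▸ ih.isTransWellOrder_step

theorem endExtends_tower (h : m ≤ n) : EndExtends (tower p n) (tower p m) := by
  induction n, h using Nat.le_induction with
  | base => exact .refl _
  | succ n _ ih => exact tower_succ p n ▸ (hp.isTransWellOrder_tower n).endExtends_step.trans ih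

theorem isTransitive_level (n : ℕ) : (level p n).IsTransitive :=
  (hp.isTransWellOrder_tower n).isTransitive

theorem level_mono (h : m ≤ n) : level p m ⊆ level p n :=
  (hp.endExtends_tower h).dom_subset

theorem exists_mem_level₂ (ha : a ∈ levelUnion p) (hb : b ∈ levelUnion p) :
    ∃ n, a ∈ level p n ∧ b ∈ level p n := by
  obtain ⟨m, ha⟩ := ha
  obtain ⟨n, hb⟩ := hb
  exact ⟨max m n, hp.level_mono (le_max_left m n) ha, hp.level_mono (le_max_right m n) hb⟩

theorem level_mem_level_succ (n : ℕ) : level p n ∈ level p (n + 1) := by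
  rw [level, level, tower_succ]
  exact (hp.isTransWellOrder_tower n).dom_mem_dom_step

theorem basicOp_mem_level {B : V → V → V} (hB : B ∈ basicOps) (hx : x ∈ level p n)
    (hy : y ∈ level p n) (hxy : B x y ⊆ level p n) : B x y ∈ level p (n + 1) := by
  rw [level, tower_succ]
  exact (hp.isTransWellOrder_tower n).mem_dom_step hB hx hy hxy

theorem pair_mem_level (hx : x ∈ level p n) (hy : y ∈ level p n) :
    pair x y ∈ level p (n + 2) := by
  have hupair : ∀ {k x y}, x ∈ level p k → y ∈ level p k → {x, y} ∈ level p (k + 1) :=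
    fun hx hy => hp.basicOp_mem_level (B := fun x y => {x, y}) (by simp [basicOps]) hx hy
      fun t ht => by rcases ZFSet.mem_pair.1 ht with rfl | rfl <;> assumption
  exact hupair (ZFSet.pair_eq_singleton x ▸ hupair hx hx) (hupair hx hy)

theorem mem_level_of_pair_mem {r : V} (hr : r ∈ level p n) (hab : pair a b ∈ r) :
    a ∈ level p n ∧ b ∈ level p n :=
  mem_of_pair_mem (hp.isTransitive_level n) ((hp.isTransitive_level n).mem_trans hab hr)

theorem sect_mem_level {r : V} (hr : r ∈ level p n) (ha : a ∈ level p n) :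
    sect r a ∈ level p (n + 1) :=
  hp.basicOp_mem_level (by simp [basicOps]) hr ha fun _ ht =>
    (hp.mem_level_of_pair_mem hr (mem_sect.1 ht)).2

theorem basicOp_subset_level {B : V → V → V} (hB : B ∈ basicOps) (hx : x ∈ level p n)
    (hy : y ∈ level p n) : B x y ⊆ level p (n + 4) := by
  have hmono : ∀ {k}, k ≤ 4 → level p (n + k) ⊆ level p (n + 4) := fun hk =>
    hp.level_mono (Nat.add_le_add_left hk n)
  have htrans : ∀ {s t}, s ∈ level p n → t ∈ s → t ∈ level p n := fun hs ht =>
    (hp.isTransitive_level n).mem_trans ht hs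
  have hpair := @hp.pair_mem_level
  have hsucc := hp.level_mono (Nat.le_add_right n 1)
  have hsucc₂ := hp.level_mono (Nat.le_add_right n 2)
  intro t ht
  simp only [basicOps, List.mem_cons, List.not_mem_nil, or_false] at hB
  rcases hB with rfl | rfl | rfl | rfl | rfl | rfl | rfl | rfl | rfl | rfl <;>
    simp only [ZFSet.mem_pair, ZFSet.mem_sdiff, ZFSet.mem_sUnion, mem_sect, memRel, fstRel, sndRel,
      compRel, forkRel, graphRel, mem_bUnion, mem_dom, ZFSet.mem_singleton] at ht
  · exact hmono zero_le (by grind)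
  · exact hmono zero_le (htrans hx ht.1)
  · obtain ⟨s, hs, ht⟩ := ht
    exact hmono zero_le (htrans (htrans hx hs) ht)
  · exact hmono zero_le (hp.mem_level_of_pair_mem hx ht).2
  · obtain ⟨s, hs, u, hu, rfl⟩ := ht
    exact hmono (by lia) (hpair (htrans hx hs) (htrans (htrans hx hs) hu))
  · obtain ⟨u, -, v, huv, rfl⟩ := ht
    obtain ⟨hu, hv⟩ := hp.mem_level_of_pair_mem hx huv
    exact hpair (hpair hu hv) (hsucc₂ hu)
  · obtain ⟨u, -, v, huv, rfl⟩ := ht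
    obtain ⟨hu, hv⟩ := hp.mem_level_of_pair_mem hx huv
    exact hpair (hpair hu hv) (hsucc₂ hv)
  · obtain ⟨u, -, v, huv, w, hvw, rfl⟩ := ht
    exact hmono (by lia)
      (hpair (hp.mem_level_of_pair_mem hx huv).1 (hp.mem_level_of_pair_mem hy hvw).2)
  · obtain ⟨u, -, v, huv, w, huw, rfl⟩ := ht
    obtain ⟨hu, hv⟩ := hp.mem_level_of_pair_mem hx huv
    exact hpair (hsucc₂ hu) (hpair hv (hp.mem_level_of_pair_mem hy huw).2)
  · obtain ⟨u, hu, rfl⟩ := ht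
    have hu := htrans hy hu
    exact hmono (k := 3) (by lia) (hpair (hsucc hu) (hp.sect_mem_level hx hu))

theorem isBasicClosed_levelUnion : IsBasicClosed (levelUnion p) := by
  intro B hB x hx y hy
  obtain ⟨n, hx, hy⟩ := hp.exists_mem_level₂ hx hy
  have hmono := hp.level_mono (Nat.le_add_right n 4)
  exact ⟨n + 5, hp.basicOp_mem_level hB (hmono hx) (hmono hy) (hp.basicOp_subset_level hB hx hy)⟩

theorem pair_mem_towerUnion_iff (hb : b ∈ level p n) :
    pair a b ∈ towerUnion p ↔ pair a b ∈ tower p n := by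
  refine ⟨fun ⟨m, hm⟩ => ?_, fun h => ⟨n, h⟩⟩
  exact (hp.endExtends_tower (le_max_right m n)).pair_mem hb
    ((hp.endExtends_tower (le_max_left m n)).subset hm)

theorem mem_level_of_pair_mem_towerUnion (hb : b ∈ level p n) (hab : pair a b ∈ towerUnion p) :
    a ∈ level p n :=
  mem_dom.2 ⟨b, (hp.pair_mem_towerUnion_iff hb).1 hab⟩

theorem wellOrders_towerUnion : WellOrders (towerUnion p) (levelUnion p) where
  refl := fun a ⟨n, ha⟩ => ⟨n, (hp.isTransWellOrder_tower n).wellOrders.refl a ha⟩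
  antisymm a ha b hb hab hba := by
    obtain ⟨n, ha, hb⟩ := hp.exists_mem_level₂ ha hb
    exact (hp.isTransWellOrder_tower n).wellOrders.antisymm a ha b hb
      ((hp.pair_mem_towerUnion_iff hb).1 hab) ((hp.pair_mem_towerUnion_iff ha).1 hba)
  trans := by
    rintro a - b - c ⟨n, hc⟩ hab hbc
    have hb := hp.mem_level_of_pair_mem_towerUnion hc hbc
    have ha := hp.mem_level_of_pair_mem_towerUnion hb hab
    exact ⟨n, (hp.isTransWellOrder_tower n).wellOrders.trans a ha b hb c hc
      ((hp.pair_mem_towerUnion_iff hb).1 hab) ((hp.pair_mem_towerUnion_iff hc).1 hbc)⟩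
  total a ha b hb := by
    obtain ⟨n, ha, hb⟩ := hp.exists_mem_level₂ ha hb
    rw [hp.pair_mem_towerUnion_iff hb, hp.pair_mem_towerUnion_iff ha]
    exact (hp.isTransWellOrder_tower n).wellOrders.total a ha b hb
  exists_least := by
    rintro S hS ⟨s, hs⟩
    obtain ⟨n, hn⟩ := hS hs
    obtain ⟨a, ⟨haS, han⟩, hmin⟩ := (hp.isTransWellOrder_tower n).wellOrders.exists_least
      (S ∩ level p n) Set.inter_subset_right ⟨s, hs, hn⟩
    refine ⟨a, haS, fun b hb => ?_⟩
    obtain ⟨m, ham, hbm⟩ := hp.exists_mem_level₂ ⟨n, han⟩ (hS hb)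
    rcases (hp.isTransWellOrder_tower m).wellOrders.total a ham b hbm with hab | hba
    · exact ⟨m, hab⟩
    · exact ⟨n, hmin b ⟨hb, hp.mem_level_of_pair_mem_towerUnion han ⟨m, hba⟩⟩⟩

end IsTransWellOrder

/-! ### Seeds and certificates -/

theorem coe_dom_eq_levelUnion {p W : V} (hW : (W : Set V) = towerUnion p) :
    (dom W : Set V) = levelUnion p := by
  have hmem : ∀ {z}, z ∈ W ↔ ∃ n, z ∈ tower p n := fun {z} => Set.ext_iff.1 hW z
  ext a
  rw [SetLike.mem_coe, mem_dom]
  simp only [hmem]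
  rw [exists_comm]
  exact exists_congr fun n => mem_dom.symm

theorem IsTransWellOrder.of_coe_eq {p W : V} (hp : IsTransWellOrder p)
    (hW : (W : Set V) = towerUnion p) : IsTransWellOrder W where
  pairs z hz := by
    have hdom : ∀ {a}, a ∈ dom W ↔ a ∈ levelUnion p := fun {a} =>
      Set.ext_iff.1 (coe_dom_eq_levelUnion hW) a
    obtain ⟨n, hn⟩ := hW.subset hz
    obtain ⟨a, ha, b, hb, rfl⟩ := (hp.isTransWellOrder_tower n).pairs z hn
    exact ⟨a, hdom.2 ⟨n, ha⟩, b, hdom.2 ⟨n, hb⟩, rfl⟩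
  wellOrders := by
    rw [coe_dom_eq_levelUnion hW, hW]
    exact hp.wellOrders_towerUnion
  isTransitive y hy t ht := by
    rw [← SetLike.mem_coe, coe_dom_eq_levelUnion hW] at hy ⊢
    obtain ⟨n, hn⟩ := hy
    exact ⟨n, (hp.isTransitive_level n).mem_trans ht hn⟩
  nonempty := by
    obtain ⟨a, ha⟩ := hp.nonempty
    exact ⟨a, (coe_dom_eq_levelUnion hW).superset ⟨0, ha⟩⟩

/-- A well-ordering of `x ∪ {x}`, for a transitive set `x`, that belongs to the rudimentary closure
of `x`.  The end extensions of a seed exhaust that closure. -/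
structure IsSeed (p x : V) : Prop extends IsTransWellOrder p where
  mem_rudClosure : p ∈ rudClosure x
  dom_eq : dom p = insert x x

/-- Each element of `C` is `p` or a one-step extension of another element of `C`. -/
def IsChain (p C : V) : Prop :=
  ∀ d ∈ C, d = p ∨ ∃ d' ∈ C, d = step d' ∧ dom d' ∈ dom d

/-- `C` certifies that `z` belongs to one of the iterated end extensions of `p`. -/
def Cert (p C z : V) : Prop :=
  IsChain p C ∧ ∃ d ∈ C, z ∈ d

theorem RudRel.cert {n : ℕ} {f g h : (Fin n → V) → V} (hf : Rudimentary f) (hg : Rudimentary g)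
    (hh : Rudimentary h) : RudRel fun v => Cert (f v) (g v) (h v) :=
  .and (.ball hg (.or (.eq (.proj 0) hf.weaken) (.bex hg.weaken
    (.and (.eq (.proj 1) (.step (.proj 0))) (.mem (.dom (.proj 0)) (.dom (.proj 1)))))))
    (.bex hg (.mem hh.weaken (.proj 0)))

theorem IsChain.exists_tower {p C d : V} (hC : IsChain p C) (hd : d ∈ C) :
    ∃ n, d = tower p n := by
  induction d using (InvImage.wf dom ZFSet.mem_wf).induction with
  | _ d ih =>
    rcases hC d hd with rfl | ⟨d', hd', rfl, hdom⟩
    · exact ⟨0, rfl⟩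
    · obtain ⟨n, rfl⟩ := ih d' hdom hd'
      exact ⟨n + 1, (tower_succ p n).symm⟩

theorem RudClosed.tower_mem {J p : V} (hJ : RudClosed J) (hp : p ∈ J) (n : ℕ) : tower p n ∈ J := by
  induction n with
  | zero => exact hp
  | succ n ih => exact tower_succ p n ▸ hJ.mem₁ (.step (.proj 0)) ih

theorem RudClosed.level_mem {J p : V} (hJ : RudClosed J) (hp : p ∈ J) (n : ℕ) : level p n ∈ J :=
  hJ.mem₁ (.dom (.proj 0)) (hJ.tower_mem hp n)

theorem IsTransWellOrder.exists_isChain {J p : V} (hp : IsTransWellOrder p) (hJ : RudClosed J)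
    (hpJ : p ∈ J) (n : ℕ) : ∃ C ∈ J, IsChain p C ∧ tower p n ∈ C := by
  induction n with
  | zero =>
    exact ⟨{p}, hJ.mem₁ (.singleton (.proj 0)) hpJ, fun d hd => .inl (ZFSet.mem_singleton.1 hd),
      ZFSet.mem_singleton.2 rfl⟩
  | succ n ih =>
    obtain ⟨C, hC, hchain, hn⟩ := ih
    refine ⟨C ∪ {tower p (n + 1)}, hJ.mem₂ (F := fun C d => C ∪ {d})
      (.union_fun (.proj 0) (.singleton (.proj 1))) hC
      (hJ.tower_mem hpJ (n + 1)), fun d hd => ?_, by simp⟩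
    have hC_sub : ∀ {d}, d ∈ C → d ∈ C ∪ {tower p (n + 1)} := fun hd => ZFSet.mem_union.2 (.inl hd)
    rcases ZFSet.mem_union.1 hd with hd | hd
    · exact (hchain d hd).imp_right fun ⟨d', hd', h⟩ => ⟨d', hC_sub hd', h⟩
    · obtain rfl := ZFSet.mem_singleton.1 hd
      exact .inr ⟨_, hC_sub hn, tower_succ p n, hp.level_mem_level_succ n⟩

namespace IsSeed

variable {p x z : V} (hp : IsSeed p x)
include hp

theorem isTransitive_base : x.IsTransitive := by
  intro y hy t ht
  have hins : (insert x x : V).IsTransitive := hp.dom_eq ▸ hp.isTransitive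
  rcases ZFSet.mem_insert_iff.1 (hins.mem_trans ht (ZFSet.mem_insert_of_mem x hy)) with rfl | h
  · exact (ZFSet.mem_asymm hy ht).elim
  · exact h

theorem tower_mem (n : ℕ) : tower p n ∈ rudClosure x :=
  (rudClosed_rudClosure x).tower_mem hp.mem_rudClosure n

theorem level_mem (n : ℕ) : level p n ∈ rudClosure x :=
  (rudClosed_rudClosure x).level_mem hp.mem_rudClosure n

theorem coe_rudClosure : (rudClosure x : Set V) = levelUnion p := by
  have hbase : ∀ {y}, y ∈ insert x x → y ∈ levelUnion p := fun {y} hy =>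
    ⟨0, show y ∈ dom p from hp.dom_eq.symm ▸ hy⟩
  refine Set.Subset.antisymm (fun z hz => ?_) fun z ⟨n, hn⟩ => ?_
  · exact hp.isBasicClosed_levelUnion.mem_of_mem_rudClosure (hbase (ZFSet.mem_insert x x))
      (fun y hy => hbase (ZFSet.mem_insert_of_mem x hy)) hz
  · exact (isTransitive_rudClosure hp.isTransitive_base).mem_trans hn (hp.level_mem n)

theorem mem_rudClosure_iff : z ∈ rudClosure x ↔ ∃ n, z ∈ level p n :=
  Set.ext_iff.1 hp.coe_rudClosure z

theorem wellOrders_rudClosure : WellOrders (towerUnion p) (rudClosure x : Set V) :=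
  hp.coe_rudClosure ▸ hp.wellOrders_towerUnion

theorem exists_pair_of_mem_towerUnion (hz : z ∈ towerUnion p) :
    ∃ a ∈ rudClosure x, ∃ b ∈ rudClosure x, z = pair a b := by
  obtain ⟨n, hn⟩ := hz
  obtain ⟨a, ha, b, hb, rfl⟩ := (hp.isTransWellOrder_tower n).pairs z hn
  exact ⟨a, hp.mem_rudClosure_iff.2 ⟨n, ha⟩, b, hp.mem_rudClosure_iff.2 ⟨n, hb⟩, rfl⟩

theorem mem_towerUnion_iff :
    z ∈ towerUnion p ↔ z ∈ rudClosure x ∧ ∃ C ∈ rudClosure x, Cert p C z := by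
  constructor
  · rintro ⟨n, hn⟩
    obtain ⟨C, hC, hchain, htower⟩ :=
      hp.exists_isChain (rudClosed_rudClosure x) hp.mem_rudClosure n
    exact ⟨(isTransitive_rudClosure hp.isTransitive_base).mem_trans hn (hp.tower_mem n),
      C, hC, hchain, _, htower, hn⟩
  · rintro ⟨-, C, -, hchain, d, hd, hz⟩
    obtain ⟨n, rfl⟩ := hchain.exists_tower hd
    exact ⟨n, hz⟩

theorem exists_mem_rudClosure_eq_towerUnion :
    ∃ W ∈ rudClosure (rudClosure x), (W : Set V) = towerUnion p := by
  refine ⟨ZFSet.sep (fun z => ∃ C ∈ rudClosure x, Cert p C z) (rudClosure x), ?_, ?_⟩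
  · exact (rudClosed_rudClosure _).mem₂
      (F := fun p J => ZFSet.sep (fun z => ∃ C ∈ J, Cert p C z) J)
      (.sep (.proj 1) (.bex (.proj 2) (.cert (.proj 2) (.proj 0) (.proj 1))))
      (subset_rudClosure _ hp.mem_rudClosure) (self_mem_rudClosure _)
  · ext z
    rw [hp.mem_towerUnion_iff, SetLike.mem_coe, ZFSet.mem_sep]

theorem exists_isSeed_rudClosure : ∃ q, IsSeed q (rudClosure x) := by
  obtain ⟨W, hWJ, hWp⟩ := hp.exists_mem_rudClosure_eq_towerUnion
  have hW := hp.of_coe_eq hWp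
  have hdom : dom W = rudClosure x :=
    SetLike.coe_injective ((coe_dom_eq_levelUnion hWp).trans hp.coe_rudClosure.symm)
  refine ⟨extension (fun _ _ => dom W) W, hW.isTransWellOrder_extension, ?_, ?_⟩
  · exact (rudClosed_rudClosure _).mem₁ (F := fun W => extension (fun _ _ => dom W) W)
      (.extension_dom (.proj 0)) hWJ
  · rw [hW.dom_extension_dom, hdom]

end IsSeed

theorem dom_singleton_pair (a b : V) : dom {pair a b} = {a} := by
  ext
  simp [pair_inj]

theorem isSeed_empty : IsSeed {pair ∅ ∅} ∅ where
  pairs := by simp [-mem_dom, dom_singleton_pair]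
  wellOrders := by
    rw [dom_singleton_pair]
    refine .of_injOn (f := fun _ => (0 : ℕ)) (fun a ha b hb _ => ?_) fun a ha b hb => ?_ <;>
      simp_all
  isTransitive y hy := by
    rw [dom_singleton_pair] at hy
    simp_all
  nonempty := ⟨∅, by simp [-mem_dom, dom_singleton_pair]⟩
  mem_rudClosure := (rudClosed_rudClosure ∅).mem₁ (F := fun x => {pair x x})
    (.singleton (.opair (.proj 0) (.proj 0))) (self_mem_rudClosure ∅)
  dom_eq := by
    rw [dom_singleton_pair]
    exact ZFSet.ext fun z => by simp

theorem exists_isSeed_J1 : ∃ p, IsSeed p J1 :=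
  isSeed_empty.exists_isSeed_rudClosure

/-! ### Definability over transitive sets closed under rudimentary functions -/

section Definability

open Set FirstOrder

section Quantifiers

variable {L : Language} {M : Type*} [L.Structure M] {A : Set M} {α : Type*}

theorem definable_exists {P : (α → M) → M → Prop}
    (h : A.Definable L {w : Option α → M | P (fun i => w (some i)) (w none)}) :
    A.Definable L {v | ∃ y, P v y} := by
  convert (h.preimage_comp fun o => o.elim (Sum.inr ()) Sum.inl).exists_of_finite using 1
  ext v
  exact ⟨fun ⟨y, hy⟩ => ⟨fun _ => y, hy⟩, fun ⟨u, hu⟩ => ⟨u (), hu⟩⟩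

theorem definable_forall {P : (α → M) → M → Prop}
    (h : A.Definable L {w : Option α → M | P (fun i => w (some i)) (w none)}) :
    A.Definable L {v | ∀ y, P v y} := by
  convert (definable_exists (P := fun v y => ¬ P v y) h.compl).compl using 1
  ext v
  simp

theorem definable_imp {P Q : (α → M) → Prop} (hP : A.Definable L {v | P v})
    (hQ : A.Definable L {v | Q v}) : A.Definable L {v | P v → Q v} := by
  convert hP.compl.union hQ using 1
  ext v
  simp [imp_iff_not_or]

end Quantifiers

theorem isDefinableSubset_iff {x : V} {Y : Set V} : IsDefinableSubset x Y ↔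
    Y ⊆ x ∧ (univ : Set x).Definable₁ setLanguage {a : x | (a : V) ∈ Y} := by
  constructor
  · rintro ⟨S, hS, rfl⟩
    refine ⟨by rintro _ ⟨a, -, rfl⟩; exact a.2, ?_⟩
    convert hS
    simp
  · rintro ⟨hYx, hY⟩
    exact ⟨_, hY, by ext y; simpa using fun hy => hYx hy⟩

variable {J : V} {α : Type}

theorem definable_mem {f g : (α → J) → J} (hf : (univ : Set J).DefinableFun setLanguage f)
    (hg : (univ : Set J).DefinableFun setLanguage g) :
    (univ : Set J).Definable setLanguage {v | (f v : V) ∈ (g v : V)} := by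
  have hmem : (∅ : Set J).Definable setLanguage {v : Fin 2 → J | (v 0 : V) ∈ (v 1 : V)} := by
    refine empty_definable_iff.2 ⟨memSymb.formula₂ (.var 0) (.var 1), ?_⟩
    ext v
    rw [mem_ofPred_eq, mem_ofPred_eq, Language.Formula.realize_rel₂]
    rfl
  exact (hmem.mono (empty_subset _)).preimage_map (F := fun v => ![f v, g v])
    (Fin.forall_fin_two.2 ⟨hf, hg⟩)

theorem IsDefinableSubset.definable_mem {Y : Set V} (hY : IsDefinableSubset J Y)
    {f : (α → J) → J} (hf : (univ : Set J).DefinableFun setLanguage f) :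
    (univ : Set J).Definable setLanguage {v | (f v : V) ∈ Y} :=
  (isDefinableSubset_iff.1 hY).2.preimage_map (F := fun v _ => f v) fun _ => hf

theorem definableFun_of_mem (hJ : J.IsTransitive) {f : (α → J) → J}
    (h : (univ : Set J).Definable setLanguage
      {w : Option α → J | (w none : V) ∈ (f fun i => w (some i) : V)}) :
    (univ : Set J).DefinableFun setLanguage f := by
  have hmem : (univ : Set J).Definable setLanguage
      {w : Option (Option α) → J | (w none : V) ∈ (w (some none) : V)} :=
    AnalysisJ2.definable_mem (.proj _) (.proj _)
  have hmemf : (univ : Set J).Definable setLanguage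
      {w : Option (Option α) → J | (w none : V) ∈ (f fun i => w (some (some i)) : V)} :=
    h.preimage_comp fun o : Option α => o.elim none fun i => some (some i)
  have hext : ∀ {a b : J}, a = b ↔ ∀ u : J, ((u : V) ∈ (b : V) → (u : V) ∈ (a : V)) ∧
      ((u : V) ∈ (a : V) → (u : V) ∈ (b : V)) := fun {a b} => by
    rw [Subtype.ext_iff, ZFSet.ext_iff]
    exact ⟨fun h u => ⟨(h u).2, (h u).1⟩, fun h z =>
      ⟨fun hz => (h ⟨z, hJ.mem_trans hz a.2⟩).2 hz, fun hz => (h ⟨z, hJ.mem_trans hz b.2⟩).1 hz⟩⟩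
  unfold DefinableFun
  convert definable_forall (P := fun (w : Option α → J) u =>
    ((u : V) ∈ (w none : V) → (u : V) ∈ (f fun i => w (some i) : V)) ∧
      ((u : V) ∈ (f fun i => w (some i) : V) → (u : V) ∈ (w none : V)))
    ((definable_imp hmem hmemf).inter (definable_imp hmemf hmem)) using 1
  ext w
  exact hext

/-- The restriction of a rudimentary function to the tuples of elements of `J`. -/
def RudClosed.restrict (hJ : RudClosed J) {n : ℕ} {F : (Fin n → V) → V} (hF : Rudimentary F)
    (v : Fin n → J) : J :=
  ⟨F fun i => v i, hJ hF _ fun i => (v i).2⟩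

namespace RudClosed

variable (hJ : RudClosed J) (ht : J.IsTransitive) {n : ℕ}
include hJ ht

theorem definableFun_restrict_union {H : (Fin (n + 1) → V) → V} (hH : Rudimentary H)
    (h : (univ : Set J).DefinableFun setLanguage (hJ.restrict hH)) :
    (univ : Set J).DefinableFun setLanguage (hJ.restrict (.union hH)) := by
  have hval : (univ : Set J).DefinableFun setLanguage
      fun w : Option (Option (Fin (n + 1))) → J =>
        hJ.restrict hH (Function.update (fun i => w (some (some i))) 0 (w none)) := by
    refine h.comp (g := fun w => Function.update (fun i => w (some (some i))) 0 (w none))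
      fun i => ?_
    cases i using Fin.cases <;> simpa using DefinableFun.proj _
  have hupdate : ∀ (v : Fin (n + 1) → J) y, (fun i => (Function.update v 0 y i : V)) =
      Function.update (fun i => (v i : V)) 0 (y : V) := fun v y => by
    ext i : 1
    cases i using Fin.cases <;> simp
  refine definableFun_of_mem ht ?_
  convert definable_exists (P := fun (w : Option (Fin (n + 1)) → J) (y : J) =>
    (y : V) ∈ (w (some 0) : V) ∧ (w none : V) ∈
      (hJ.restrict hH (Function.update (fun i => w (some i)) 0 y) : V))
    ((definable_mem (.proj _) (.proj _)).inter (definable_mem (.proj _) hval)) using 1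
  ext w
  simp only [restrict, mem_ofPred_eq, ZFSet.mem_iUnion, hupdate, Subtype.exists]
  exact ⟨fun ⟨y, hy, h⟩ => ⟨y, ht.mem_trans hy (w (some 0)).2, hy, h⟩,
    fun ⟨y, _, hy, h⟩ => ⟨y, hy, h⟩⟩

theorem definableFun_restrict {F : (Fin n → V) → V} (hF : Rudimentary F) :
    (univ : Set J).DefinableFun setLanguage (hJ.restrict hF) := by
  induction hF with
  | proj i => exact .proj _
  | pair i j =>
    refine definableFun_of_mem ht ?_
    convert (DefinableFun.ofPred_eq (L := setLanguage) (A := (univ : Set J))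
      (f := fun w => w none) (g := fun w => w (some i)) (.proj _) (.proj _)).union
      (DefinableFun.ofPred_eq (f := fun w => w none) (g := fun w => w (some j)) (.proj _) (.proj _))
      using 1
    ext w
    simp only [restrict, mem_union, mem_ofPred_eq, ZFSet.mem_pair, ← SetLike.coe_eq_coe]
  | diff i j =>
    refine definableFun_of_mem ht ?_
    convert (definable_mem (J := J) (f := fun w => w none) (g := fun w => w (some i))
      (.proj _) (.proj _)).sdiff (definable_mem (f := fun w => w none) (g := fun w => w (some j))
      (.proj _) (.proj _)) using 1
    ext w
    simp [restrict]
  | comp _ hH ihG ihH => exact DefinableFun.comp (g := fun v i => hJ.restrict (hH i) v) ihH ihG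
  | union hH ih => exact hJ.definableFun_restrict_union ht hH ih

theorem definable {P : (Fin n → V) → Prop} (hP : RudRel P) :
    (univ : Set J).Definable setLanguage {v : Fin n → J | P fun i => v i} := by
  obtain ⟨F, hF, hPF⟩ := hP
  convert definable_exists (P := fun (v : Fin n → J) (u : J) => (u : V) ∈ (hJ.restrict hF v : V))
    (definable_mem (.proj _) ((hJ.definableFun_restrict ht hF).comp fun i => .proj _)) using 1
  ext v
  simp only [mem_ofPred_eq, hPF, restrict, Subtype.exists]
  exact ⟨fun ⟨u, hu⟩ => ⟨u, ht.mem_trans hu (hJ hF _ fun i => (v i).2), hu⟩,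
    fun ⟨u, _, hu⟩ => ⟨u, hu⟩⟩

theorem isDefinableSubset_quotient {W X E : Set V} (hW : IsDefinableSubset J W)
    (hX : IsDefinableSubset J X) (hE : IsDefinableSubset J E) :
    IsDefinableSubset J (quotient W X E) := by
  have hXJ := (isDefinableSubset_iff.1 hX).1
  have hopair : Rudimentary fun v : Fin 2 → V => ZFSet.pair (v 0) (v 1) :=
    .opair (.proj 0) (.proj 1)
  have hpair : (univ : Set J).DefinableFun setLanguage
      fun w : Option (Fin 1) → J => hJ.restrict hopair ![w (some 0), w none] :=
    (hJ.definableFun_restrict ht hopair).comp (g := fun w => ![w (some 0), w none])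
      (Fin.forall_fin_two.2 ⟨.proj _, .proj _⟩)
  refine isDefinableSubset_iff.2 ⟨fun a ha => hXJ ha.1, ?_⟩
  unfold Definable₁
  convert (hX.definable_mem (f := fun v : Fin 1 → J => v 0) (.proj _)).inter
    (definable_forall (P := fun (v : Fin 1 → J) (b : J) =>
        (b : V) ∈ X ∧ ZFSet.pair (v 0 : V) b ∈ E → ZFSet.pair (v 0 : V) b ∈ W)
      (definable_imp ((hX.definable_mem (.proj _)).inter (hE.definable_mem hpair))
        (hW.definable_mem hpair))) using 1
  ext v
  simp only [quotient, mem_ofPred_eq, mem_inter_iff, Subtype.forall]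
  exact and_congr_right fun _ => forall_congr' fun b => ⟨fun h _ => h, fun h hb => h (hXJ hb.1) hb⟩

end RudClosed

theorem IsSeed.isDefinableSubset_towerUnion {p x : V} (hp : IsSeed p x) :
    IsDefinableSubset (rudClosure x) (towerUnion p) := by
  have ht := isTransitive_rudClosure hp.isTransitive_base
  have hcert := ((rudClosed_rudClosure x).definable ht
    (.cert (.proj 0) (.proj 1) (.proj 2) : RudRel fun v : Fin 3 → V => Cert (v 0) (v 1) (v 2)))
  refine isDefinableSubset_iff.2 ⟨fun z hz => (hp.mem_towerUnion_iff.1 hz).1, ?_⟩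
  unfold Definable₁
  convert definable_exists (P := fun (v : Fin 1 → rudClosure x) C => Cert p C (v 0))
    (hcert.preimage_map (F := fun w => ![⟨p, hp.mem_rudClosure⟩, w none, w (some 0)])
      (Fin.forall_fin_succ.2
        ⟨setLanguage.definableFun_const _ (mem_univ _), Fin.forall_fin_two.2 ⟨.proj _, .proj _⟩⟩))
    using 1
  ext v
  simp only [mem_ofPred_eq, hp.mem_towerUnion_iff, Subtype.exists]
  grind

end Definability

/-! ### Universal well-orderings of `J₂` -/

theorem WellOrders.exists_eq_of_isInitial {W X S : Set V} (hW : WellOrders W X) (hS : S ⊂ X)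
    (hinit : ∀ a ∈ S, ∀ b ∈ X, pair b a ∈ W → b ∈ S) :
    ∃ c ∈ X, S = {b | b ∈ X ∧ pair b c ∈ W ∧ b ≠ c} := by
  obtain ⟨c, ⟨hc, hcS⟩, hmin⟩ := hW.exists_least (X \ S) Set.sdiff_subset
    (Set.nonempty_of_ssubset hS)
  refine ⟨c, hc, Set.ext fun b => ⟨fun hb => ⟨hS.1 hb, ?_, ?_⟩, fun ⟨hb, hbc, hne⟩ => ?_⟩⟩
  · exact (hW.total b (hS.1 hb) c hc).resolve_right fun hcb => hcS (hinit b hb c hc hcb)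
  · rintro rfl
    exact hcS hb
  · by_contra hbS
    exact hne (hW.antisymm b hb c hc hbc (hmin b ⟨hb, hbS⟩))

namespace IsSeed

variable {p x y c : V} (hp : IsSeed p x)
include hp

theorem exists_mem_rudClosure_eq_towerUnion_inter (hy : y ∈ rudClosure x) :
    ∃ s ∈ rudClosure x, (s : Set V) = towerUnion p ∩ y := by
  obtain ⟨n, hn⟩ := hp.mem_rudClosure_iff.1 hy
  refine ⟨tower p n ∩ y, (rudClosed_rudClosure x).mem₂ (F := fun x y => x ∩ y)
    (.inter (.proj 0) (.proj 1)) (hp.tower_mem n) hy, ?_⟩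
  ext z
  simp only [SetLike.mem_coe, ZFSet.mem_inter, Set.mem_inter_iff]
  refine and_congr_left fun hz => ⟨fun h => ⟨n, h⟩, fun h => ?_⟩
  obtain ⟨a, -, b, -, rfl⟩ := hp.exists_pair_of_mem_towerUnion h
  exact (hp.pair_mem_towerUnion_iff (hp.mem_level_of_pair_mem hn hz).2).1 h

theorem exists_mem_rudClosure_eq_lt (hc : c ∈ rudClosure x) :
    ∃ s ∈ rudClosure x, (s : Set V) = {b | b ∈ rudClosure x ∧ pair b c ∈ towerUnion p ∧ b ≠ c} := by
  obtain ⟨n, hn⟩ := hp.mem_rudClosure_iff.1 hc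
  refine ⟨ZFSet.sep (fun b => pair b c ∈ tower p n ∧ b ≠ c) (dom (tower p n)),
    (rudClosed_rudClosure x).mem₂
      (F := fun w c => ZFSet.sep (fun b => pair b c ∈ w ∧ b ≠ c) (dom w))
      (.sep (.dom (.proj 0)) (.and (.mem (.opair (.proj 0) (.proj 2)) (.proj 1))
        (.not (.eq (.proj 0) (.proj 2))))) (hp.tower_mem n) hc, ?_⟩
  ext b
  simp only [SetLike.mem_coe, ZFSet.mem_sep, Set.mem_ofPred_eq, hp.pair_mem_towerUnion_iff hn]
  refine and_congr_left fun h => ⟨fun hb => hp.mem_rudClosure_iff.2 ⟨n, hb⟩, fun _ => ?_⟩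
  exact mem_dom.2 ⟨c, h.1⟩

end IsSeed

theorem IsSeed.isInitialSegment_level {p : V} (hp : IsSeed p J1) (n : ℕ) :
    IsInitialSegment (towerUnion p) (level p n) := by
  refine ⟨⟨fun z hz => hp.mem_rudClosure_iff.2 ⟨n, hz⟩, fun h => ?_⟩, fun a ha b _ hba =>
    hp.mem_level_of_pair_mem_towerUnion ha hba⟩
  exact ZFSet.mem_irrefl _ (h (hp.level_mem n))

theorem IsSeed.isUniversalWellOrdering {p : V} (hp : IsSeed p J1) :
    IsUniversalWellOrdering (towerUnion p) where
  iotaRelation := by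
    refine ⟨⟨hp.isDefinableSubset_towerUnion, ?_⟩, fun z => hp.exists_pair_of_mem_towerUnion⟩
    rintro _ ⟨y, hy, rfl⟩
    exact hp.exists_mem_rudClosure_eq_towerUnion_inter hy
  wellOrders := hp.wellOrders_rudClosure
  initialSegment_isIotaSet S hS := by
    obtain ⟨c, hc, rfl⟩ := hp.wellOrders_rudClosure.exists_eq_of_isInitial hS.1 hS.2
    exact hp.exists_mem_rudClosure_eq_lt hc
  exists_initialSegment := by
    rintro _ ⟨y, hy, rfl⟩
    obtain ⟨n, hn⟩ := hp.mem_rudClosure_iff.1 hy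
    exact ⟨_, hp.isInitialSegment_level n, hp.isTransitive_level n y hn⟩

theorem exists_isUniversalWellOrdering : ∃ W, IsUniversalWellOrdering W :=
  let ⟨_, hp⟩ := exists_isSeed_J1
  ⟨_, hp.isUniversalWellOrdering⟩

/-! ### Quotients -/

theorem IsIotaSet.inter {X Y : Set V} (hX : IsIotaSet X) (hY : IsIotaSet Y) :
    IsIotaSet (X ∩ Y) := by
  obtain ⟨x, hx, rfl⟩ := hX
  obtain ⟨y, hy, rfl⟩ := hY
  exact ⟨x ∩ y, (rudClosed_rudClosure J1).mem₂ (F := fun x y => x ∩ y)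
    (.inter (.proj 0) (.proj 1)) hx hy, by ext; simp⟩

theorem IsIotaClass.exists_inter_prod {E : Set V} (hE : IsIotaClass E) {x : V} (hx : x ∈ J2) :
    ∃ e ∈ J2, ∀ a b, pair a b ∈ e ↔ pair a b ∈ E ∧ a ∈ x ∧ b ∈ x := by
  have hprod : (bUnion x fun a => bUnion x fun b => {pair a b}) ∈ J2 :=
    (rudClosed_rudClosure J1).mem₁ (F := fun x => bUnion x fun a => bUnion x fun b => {pair a b})
      (.bUnion (.proj 0) (.bUnion (.proj 1) (.singleton (.opair (.proj 1) (.proj 0))))) hx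
  obtain ⟨e, he, heq⟩ := hE.2 _ ⟨_, hprod, rfl⟩
  refine ⟨e, he, fun a b => ?_⟩
  rw [← SetLike.mem_coe, heq]
  simp only [Set.mem_inter_iff, SetLike.mem_coe, mem_bUnion, ZFSet.mem_singleton, pair_inj]
  grind

theorem isIotaSet_quotient {W X E : Set V} (hW : IsIotaClass W) (hX : IsIotaSet X)
    (hE : IsIotaClass E) : IsIotaSet (quotient W X E) := by
  obtain ⟨x, hx, rfl⟩ := hX
  obtain ⟨e, he, mem_e⟩ := hE.exists_inter_prod hx
  obtain ⟨w, hw, mem_w⟩ := hW.exists_inter_prod hx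
  have hJ := rudClosed_rudClosure J1
  have hew : e \ w ∈ J2 := hJ.mem₂ (F := fun e w => e \ w) (.diff 0 1) he hw
  refine ⟨x \ dom (e \ w), hJ.mem₂ (F := fun x r => x \ dom r)
    (.sdiff (.proj 0) (.dom (.proj 1))) hx hew, ?_⟩
  ext a
  simp only [SetLike.mem_coe, ZFSet.mem_sdiff, mem_dom, mem_e, mem_w, quotient, Set.mem_ofPred_eq]
  grind

theorem quotient_inter_eq {W X E S : Set V} (hW : WellOrders W (J2 : Set V))
    (hX : X ⊆ (J2 : Set V)) (hS : IsInitialSegment W S) :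
    quotient W (X ∩ S) E = quotient W X E ∩ S := by
  ext a
  refine ⟨fun ⟨⟨haX, haS⟩, hmin⟩ => ⟨⟨haX, fun b ⟨hbX, hab⟩ => ?_⟩, haS⟩,
    fun ⟨⟨haX, hmin⟩, haS⟩ => ⟨⟨haX, haS⟩, fun b ⟨hb, hab⟩ => hmin b ⟨hb.1, hab⟩⟩⟩
  -- An element of `X` outside of `S` lies above all the elements of `S`.
  rcases hW.total a (hX haX) b (hX hbX) with h | hba
  · exact h
  · exact hmin b ⟨⟨hbX, hS.2 a haS b (hX hbX) hba⟩, hab⟩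

theorem isIotaClass_quotient {W X E : Set V} (hW : IsUniversalWellOrdering W)
    (hX : IsIotaClass X) (hE : IsIotaClass E) : IsIotaClass (quotient W X E) := by
  refine ⟨(rudClosed_rudClosure J1).isDefinableSubset_quotient isTransitive_J2
    hW.iotaRelation.1.1 hX.1 hE.1, fun Y hY => ?_⟩
  obtain ⟨S, hS, hYS⟩ := hW.exists_initialSegment Y hY
  have hXS : IsIotaSet (quotient W (X ∩ S) E) :=
    isIotaSet_quotient hW.iotaRelation.1 (hX.2 S (hW.initialSegment_isIotaSet S hS)) hE
  rw [quotient_inter_eq hW.wellOrders (isDefinableSubset_iff.1 hX.1).1 hS] at hXS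
  rw [← Set.inter_eq_self_of_subset_right hYS, ← Set.inter_assoc]
  exact hXS.inter hY

end AnalysisJ2

theorem proposition2p14_general :
    (∃ W : Set ZFSet.{0}, AnalysisJ2.IsUniversalWellOrdering W) ∧
    ∀ W : Set ZFSet.{0}, AnalysisJ2.IsUniversalWellOrdering W →
      ∀ X E : Set ZFSet.{0}, AnalysisJ2.IsIotaClass E →
        (AnalysisJ2.IsIotaSet X → AnalysisJ2.IsIotaSet (AnalysisJ2.quotient W X E)) ∧
        (AnalysisJ2.IsIotaClass X → AnalysisJ2.IsIotaClass (AnalysisJ2.quotient W X E)) :=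
  ⟨AnalysisJ2.exists_isUniversalWellOrdering, fun _ hW _ _ hE =>
    ⟨fun hX => AnalysisJ2.isIotaSet_quotient hW.iotaRelation.1 hX hE,
      fun hX => AnalysisJ2.isIotaClass_quotient hW hX hE⟩⟩

/-- A universal well-ordering of `J₂` exists and, whichever one is used to pick representatives,
quotients of `ι`-sets are `ι`-sets and quotients of `ι`-classes are `ι`-classes. -/
theorem proposition2p14 :
    (∃ W : Set ZFSet.{0}, AnalysisJ2.IsUniversalWellOrdering W) ∧
    ∀ W : Set ZFSet.{0}, AnalysisJ2.IsUniversalWellOrdering W →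
      (∀ X E : Set ZFSet.{0}, AnalysisJ2.IsIotaSet X →
        AnalysisJ2.IsEquivalenceIotaRelation E X →
        AnalysisJ2.IsIotaSet (AnalysisJ2.quotient W X E)) ∧
      (∀ X E : Set ZFSet.{0}, AnalysisJ2.IsIotaClass X →
        AnalysisJ2.IsEquivalenceIotaRelation E X →
        AnalysisJ2.IsIotaClass (AnalysisJ2.quotient W X E)) :=
  proposition2p14_general.imp_right fun h W hW =>
    ⟨fun X E hX hE => (h W hW X E hE.iotaRelation.1).1 hX,
      fun X E hX hE => (h W hW X E hE.iotaRelation.1).2 hX⟩
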